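/- Let $d\in\mathbb N$, let $H,J$ be complex Hilbert spaces, let $\mathbb F^d$ be the free monoid on $d$ letters with unit $\emptyset$, and for a Hilbert space $V$ let $F^2_d\otimes V=\ell^2(\mathbb F^d;V)$, with $(e_\alpha\otimes v)$ the vector that is $v$ at $\alpha$ and $0$ elsewhere. The left free shifts are the isometries $L_j(e_\alpha\otimes v)=e_{j\alpha}\otimes v$. The vector $f=\sum_\alpha e_\alpha\otimes f_\alpha$ is identified with the free function $f(Z)=\sum_\alpha Z^\alpha\otimes f_\alpha$ on the NC unit ball, the set of all $d$-tuples $Z=(Z_1,\dots,Z_d)$ of complex $n\times n$ matrices, $n\ge 1$, whose row operator $\mathbb C^n\otimes\mathbb C^d\to\mathbb C^n$ has norm $<1$; here $Z^\alpha=Z_{i_1}\cdots Z_{i_m}$ for $\alpha=i_1\cdots i_m$. The right free Schur class $\mathscr R_d(H,J)$ consists of the contractions $A=A(R):F^2_d\otimes H\to F^2_d\otimes J$ for which there are operators $A_\beta\in\mathcal L(H,J)$, $\beta\in\mathbb F^d$, with $(Af)_\gamma=\sum_{\alpha\beta=\gamma}A_\beta f_\alpha$ for all $f$ and $\gamma$,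 that is, right multiplication by $A^\dagger(Z)=\sum_\beta Z^\beta\otimes A_\beta$. Put $A(0)=A_\emptyset$. The right free de Branges–Rovnyak space $\mathscr H^R(A)$ is the NC reproducing kernel Hilbert space, of $J$-valued functions on the NC unit ball, with kernel $$K^A(Z,W)[P]=K(Z,W)[P]\otimes I_J-(K(Z,W)\otimes I_J)\big[A^\dagger(Z)(P\otimes I_H)A^\dagger(W)^*\big],\qquad K(Z,W)[P]=\sum_\alpha Z^\alpha P(W^\alpha)^* .$$ It is *$L$-invariant* if for every $F\in\mathscr H^R(A)$ and every $j$ the function $Z\mapsto Z_jF(Z)$ belongs to $\mathscr H^R(A)$. For $h\in H$ let $Ah=A(e_\emptyset\otimes h)$, the function $A^\dagger(Z)h$. Let $\mathbf A=(L^*\otimes I_J)A:H\to\mathscr H^R(A)\otimes\mathbb C^d$, $\mathbf Ah=(L_j^*Ah)_{j=1}^d$; this is a well-defined bounded operator with $\mathbf A^*\mathbf A\le I-A(0)^*A(0)$. Let $a_\emptyset\ge0$ be the positive square root of $I-A(0)^*A(0)-\mathbf A^*\mathbf A$. Let $\hat A$ be the (generally unbounded) operator from $H$ to $\mathscr H^R(A)$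 with $\mathrm{Dom}(\hat A)=\{h\in H:\ Ah\in\mathscr H^R(A)\}$ and $\hat Ah=Ah$. **Corollary 5.11.** Let $A\in\mathscr R_d(H,J)$. Then $\mathrm{ran}(a_\emptyset)=\mathrm{Dom}(\hat A)$, and the following are equivalent: (i) $\mathscr H^R(A)$ is invariant under the left free shifts $L$; (ii) $\mathrm{ran}(\mathbf A^*)\subseteq\mathrm{ran}(a_\emptyset)$; (iii) there is $0<\rho<1$ with $\mathbf A^*\mathbf A\le\rho\,(I-A(0)^*A(0))$. Consider also the condition (iv) $\hat A$ is densely defined, $I+\hat A^*\hat A$ has a bounded everywhere defined inverse, and there is $0<r<1$ with $r\,(I-A(0)^*A(0))\le(I+\hat A^*\hat A)^{-1}$. Then (iv) implies (i); and if $A(0)$ is a pure contraction, that is, $\|A(0)h\|<\|h\|$ for all $h\ne0$, then (i) implies (iv), so that all four conditions are equivalent. -/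

import Mathlib

noncomputable section

namespace FreeDBR

open scoped ENNReal InnerProductSpace ComplexOrder
open ContinuousLinearMap (adjoint)

/-! ### The full Fock space and the left free shifts -/

/-- The full Fock space over `ℂ^d` tensored with `V`, realised as `ℓ²(𝔽^d; V)`. A word of the free
monoid `𝔽^d` is a list of letters, concatenation is `++`, and the empty word is `[]`; the family
`f` stands for `∑ α, e_α ⊗ f α`. -/
abbrev FockSpace (d : ℕ) (V : Type*) [NormedAddCommGroup V] : Type _ :=
  lp (fun _ : List (Fin d) => V) 2

section Shift

set_option linter.unusedSectionVars false

variable {d : ℕ} {V : Type*} [NormedAddCommGroup V] [InnerProductSpace ℂ V]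

/-- The coefficients of `L_j f`: `e_α ⊗ v` is sent to `e_{jα} ⊗ v`. -/
def shiftCoeff (j : Fin d) (f : List (Fin d) → V) : List (Fin d) → V
  | [] => 0
  | i :: β => if i = j then f β else 0

theorem shiftCoeff_cons (j : Fin d) (f : List (Fin d) → V) (β : List (Fin d)) :
    shiftCoeff j f (j :: β) = f β := by simp [shiftCoeff]

theorem shiftCoeff_eq_zero (j : Fin d) (f : List (Fin d) → V) (α : List (Fin d))
    (h : α ∉ Set.range (List.cons j)) : shiftCoeff j f α = 0 := by
  cases α with
  | nil => rfl
  | cons i β =>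
    have hij : i ≠ j := by
      rintro rfl
      exact h ⟨β, rfl⟩
    simp [shiftCoeff, hij]

theorem memℓp_shiftCoeff (j : Fin d) (f : FockSpace d V) : Memℓp (shiftCoeff j f) 2 := by
  have hf := (lp.memℓp f).summable (by norm_num)
  refine memℓp_gen ?_
  refine ((List.cons_injective (a := j)).summable_iff ?_).1 ?_
  · intro α hα
    simp [shiftCoeff_eq_zero j f α hα]
  · simpa [Function.comp_def, shiftCoeff_cons] using hf

/-- The left free shift `L_j ⊗ I_V`, an isometry of the Fock space. -/
def leftShift (j : Fin d) : FockSpace d V →ₗᵢ[ℂ] FockSpace d V where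
  toFun f := ⟨shiftCoeff j f, memℓp_shiftCoeff j f⟩
  map_add' f g := by
    ext α
    show shiftCoeff j (⇑(f + g)) α = shiftCoeff j f α + shiftCoeff j g α
    cases α with
    | nil => simp [shiftCoeff]
    | cons i β => by_cases h : i = j <;> simp [shiftCoeff, h]
  map_smul' c f := by
    ext α
    cases α with
    | nil => simp [shiftCoeff]
    | cons i β => by_cases h : i = j <;> simp [shiftCoeff, h]
  norm_map' f := by
    have h2 : 0 < (2 : ℝ≥0∞).toReal := by norm_num
    refine (Real.rpow_left_injOn h2.ne').eq_iff (norm_nonneg _) (norm_nonneg _) |>.1 ?_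
    show _ ^ (2 : ℝ≥0∞).toReal = _ ^ (2 : ℝ≥0∞).toReal
    rw [lp.norm_rpow_eq_tsum h2, lp.norm_rpow_eq_tsum h2]
    rw [← (List.cons_injective (a := j)).tsum_eq]
    · simp [shiftCoeff_cons]
    · intro α hα
      by_contra hn
      exact hα (by simp [shiftCoeff_eq_zero j f α hn])

theorem leftShift_apply (j : Fin d) (f : FockSpace d V) (α : List (Fin d)) :
    leftShift j f α = shiftCoeff j f α := rfl

theorem inner_leftShift (i j : Fin d) (f g : FockSpace d V) :
    ⟪leftShift i f, leftShift j g⟫_ℂ = if i = j then ⟪f, g⟫_ℂ else 0 := by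
  split_ifs with h
  · subst h
    exact (leftShift i).inner_map_map f g
  · rw [lp.inner_eq_tsum]
    refine (tsum_congr fun α => ?_).trans tsum_zero
    rw [leftShift_apply, leftShift_apply]
    cases α with
    | nil => simp [shiftCoeff]
    | cons k β =>
      by_cases hk : k = i
      · subst hk
        simp [shiftCoeff, h]
      · simp [shiftCoeff, hk]

/-- The constant function `I ⊗ h`, i.e. the vector `e_∅ ⊗ h`. -/
def const : V →L[ℂ] FockSpace d V :=
  LinearMap.mkContinuous
    (lp.lsingle (𝕜 := ℂ) (E := fun _ : List (Fin d) => V) 2 ([] : List (Fin d))) 1 fun h => by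
      have := lp.norm_single (E := fun _ : List (Fin d) => V) (p := 2) (by norm_num) [] h
      rw [one_mul]
      exact this.le

theorem const_apply (h : V) :
    (const h : FockSpace d V) = lp.single (E := fun _ : List (Fin d) => V) 2 [] h := rfl

end Shift

/-! ### The right free Schur class -/

/-- The right free Schur class: contractions `F²_d ⊗ H → F²_d ⊗ J` that act as right multiplication
by a free power series with operator coefficients.  As a right multiplier, `A = A(R)` sends `f` to
`f(Z) •_R A^†(Z)` where `A^†(Z) = ∑ β, Z^β ⊗ coeff β`; since
`(Z^α ⊗ x) •_R (Z^β ⊗ T) = Z^{αβ} ⊗ T x`, the coefficient of the product at a word `γ` is the sum,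
over all ways to write `γ = αβ`, of `coeff β (f α)`. -/
structure RightSchur (d : ℕ) (H J : Type*) [NormedAddCommGroup H] [InnerProductSpace ℂ H]
    [NormedAddCommGroup J] [InnerProductSpace ℂ J] where
  /-- The multiplication operator `A(R)`. -/
  op : FockSpace d H →L[ℂ] FockSpace d J
  /-- The Taylor coefficients at `0` of `A^†(Z)`. -/
  coeff : List (Fin d) → H →L[ℂ] J
  op_apply : ∀ (f : FockSpace d H) (γ : List (Fin d)),
    op f γ = ∑ k ∈ Finset.range (γ.length + 1), coeff (γ.drop k) (f (γ.take k))
  norm_le : ‖op‖ ≤ 1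

/-- The value `A(0) = A^†(0)`. -/
def RightSchur.zeroVal {d : ℕ} {H J : Type*} [NormedAddCommGroup H] [InnerProductSpace ℂ H]
    [NormedAddCommGroup J] [InnerProductSpace ℂ J] (A : RightSchur d H J) : H →L[ℂ] J :=
  A.coeff []

/-! ### The non-commutative unit ball and evaluation -/

open scoped Matrix.Norms.L2Operator in
/-- A point of the NC unit ball at level `n ≥ 1`: a `d`-tuple of complex `n × n` matrices such that
the row `(Z_1, …, Z_d) : ℂ^n ⊗ ℂ^d → ℂ^n` has operator norm `< 1`. -/
structure NCBall (d : ℕ) where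
  n : ℕ
  n_pos : 0 < n
  Z : Fin d → Matrix (Fin n) (Fin n) ℂ
  norm_lt : ‖(Matrix.of fun i jk => Z jk.1 i jk.2 : Matrix (Fin n) (Fin d × Fin n) ℂ)‖ < 1

/-- The monomial `Z^α = Z_{i_1} ⋯ Z_{i_m}` for `α = i_1 ⋯ i_m`. -/
def NCBall.mon {d : ℕ} (Z : NCBall d) (α : List (Fin d)) : Matrix (Fin Z.n) (Fin Z.n) ℂ :=
  (α.map Z.Z).prod

/-- The index `{Z, y, v}` of a kernel vector: a point `Z` of the NC unit ball at level `n`, and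
`y, v ∈ ℂ^n`. A `J`-valued function `F` on the NC ball, `F(Z) ∈ ℂ^{n×n} ⊗ J`, is regarded as the
function `{Z, y, v} ↦ y^* F(Z) v ∈ J`, which determines it. -/
structure NCPoint (d : ℕ) extends NCBall d where
  y : Fin n → ℂ
  v : Fin n → ℂ

namespace NCPoint

variable {d : ℕ} {V : Type*} [NormedAddCommGroup V] [InnerProductSpace ℂ V]

/-- The scalar `y^* Z^α v`. -/
def coeff (p : NCPoint d) (α : List (Fin d)) : ℂ := star p.y ⬝ᵥ (p.mon α).mulVec p.v

/-- `{Z, Z_j^* y, v}`; as `(Z_j^* y)^* F(Z) v = y^* (Z_j F(Z)) v`, evaluating `F` here is evaluating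
`Z_j F(Z)` at `{Z, y, v}`. -/
def mulLeft (p : NCPoint d) (j : Fin d) : NCPoint d :=
  { p with y := ((p.Z j).conjTranspose).mulVec p.y }

/-- The value `y^* f(Z) v` of the free function `f(Z) = ∑ α, Z^α ⊗ f_α` of a Fock space vector. -/
def eval (p : NCPoint d) (f : FockSpace d V) : V := ∑' α, p.coeff α • f α

end NCPoint

/-! ### The right free de Branges-Rovnyak kernel and space -/

section Kernel

variable {d : ℕ} {H J : Type*}
  [NormedAddCommGroup H] [InnerProductSpace ℂ H] [CompleteSpace H]
  [NormedAddCommGroup J] [InnerProductSpace ℂ J] [CompleteSpace J]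

/-- The value `A^†(Z) = ∑ β, Z^β ⊗ coeff β ∈ ℂ^{n×n} ⊗ L(H, J)`. -/
def RightSchur.dagger (A : RightSchur d H J) (Z : NCBall d) :
    Matrix (Fin Z.n) (Fin Z.n) (H →L[ℂ] J) :=
  .of fun i j => ∑' β, Z.mon β i j • A.coeff β

/-- The NC Szegő kernel `K(Z,W)[Q] = ∑ α, Z^α Q (W^α)^*`, amplified to matrices `Q` with entries in
`E`. (If `α^†` is the reversed word then `(W^*)^{α^†} = (W^α)^*`.) -/
def szego {E : Type*} [AddCommGroup E] [Module ℂ E] [TopologicalSpace E] (Z W : NCBall d)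
    (Q : Matrix (Fin Z.n) (Fin W.n) E) : Matrix (Fin Z.n) (Fin W.n) E :=
  .of fun i j => ∑' α, ∑ k, ∑ l, (Z.mon α i k * star (W.mon α j l)) • Q k l

/-- The right free de Branges-Rovnyak kernel
`K^A(Z,W)[P] = K(Z,W)[P] ⊗ I_J - (K(Z,W) ⊗ I_J)[A^†(Z) (P ⊗ I_H) A^†(W)^*]`. -/
def RightSchur.ncKernel (A : RightSchur d H J) (Z W : NCBall d)
    (P : Matrix (Fin Z.n) (Fin W.n) ℂ) : Matrix (Fin Z.n) (Fin W.n) (J →L[ℂ] J) :=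
  (.of fun i j => szego Z W P i j • ContinuousLinearMap.id ℂ J) -
    szego Z W (.of fun i j => ∑ k, ∑ l, P k l • (A.dagger Z i k ∘L adjoint (A.dagger W j l)))

/-- The Gram kernel of the vectors `K^A{Z,y,v} g`:
`⟨K^A{Z,y,v} g, K^A{W,x,u} f⟩ = (y ⊗ g, K^A(Z,W)[v u^*] (x ⊗ f))`. -/
def RightSchur.gram (A : RightSchur d H J) : Matrix (NCPoint d) (NCPoint d) (J →L[ℂ] J) :=
  .of fun p q => ∑ i, ∑ j, (star (p.y i) * q.y j) •
    A.ncKernel p.toNCBall q.toNCBall (Matrix.vecMulVec p.v (star q.v)) i j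

end Kernel

/-! #### Convergence of the series and positivity of the kernel -/

section Bounds

variable {d : ℕ}

open scoped Matrix.Norms.L2Operator in
theorem NCBall.row_bound (Z : NCBall d) : ∃ r : ℝ, 0 ≤ r ∧ r < 1 ∧ ∀ y : Fin Z.n → ℂ,
    ∑ j, ∑ k, ‖((Z.Z j).conjTranspose.mulVec y) k‖ ^ 2 ≤ r * ∑ k, ‖y k‖ ^ 2 := by
  set M : Matrix (Fin Z.n) (Fin d × Fin Z.n) ℂ := Matrix.of fun i jk => Z.Z jk.1 i jk.2 with hM
  have hlt : ‖M‖ < 1 := Z.norm_lt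
  refine ⟨‖M‖ ^ 2, by positivity, by nlinarith [norm_nonneg M], fun y => ?_⟩
  have h := Matrix.l2_opNorm_mulVec M.conjTranspose (WithLp.toLp 2 y)
  rw [Matrix.l2_opNorm_conjTranspose] at h
  have h2 := pow_le_pow_left₀ (norm_nonneg _) h 2
  rw [mul_pow, EuclideanSpace.norm_sq_eq, EuclideanSpace.norm_sq_eq, Fintype.sum_prod_type] at h2
  simpa [hM, Matrix.mulVec, dotProduct, Matrix.conjTranspose_apply] using h2

/-- All words of length at most `N`. -/
def words (d : ℕ) : ℕ → Finset (List (Fin d))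
  | 0 => {[]}
  | N + 1 => insert [] (Finset.univ.biUnion fun j => (words d N).image (List.cons j))

theorem mem_words (N : ℕ) (α : List (Fin d)) (h : α.length ≤ N) : α ∈ words d N := by
  induction N generalizing α with
  | zero => simpa [words] using h
  | succ N ih =>
    cases α with
    | nil => simp [words]
    | cons i β => simpa [words] using ih β (by simpa using h)

theorem NCBall.mon_cons (Z : NCBall d) (j : Fin d) (α : List (Fin d)) :
    Z.mon (j :: α) = Z.Z j * Z.mon α := by simp [NCBall.mon]

theorem NCBall.mon_append (Z : NCBall d) (α β : List (Fin d)) :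
    Z.mon (α ++ β) = Z.mon α * Z.mon β := by simp [NCBall.mon]

theorem NCBall.sum_words_le (Z : NCBall d) {r : ℝ} (hr0 : 0 ≤ r) (hr : r < 1)
    (hZ : ∀ y : Fin Z.n → ℂ,
      ∑ j, ∑ k, ‖((Z.Z j).conjTranspose.mulVec y) k‖ ^ 2 ≤ r * ∑ k, ‖y k‖ ^ 2)
    (N : ℕ) (y : Fin Z.n → ℂ) :
    ∑ α ∈ words d N, ∑ k, ‖((Z.mon α).conjTranspose.mulVec y) k‖ ^ 2
      ≤ (1 - r)⁻¹ * ∑ k, ‖y k‖ ^ 2 := by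
  have h1 : 0 < 1 - r := by linarith
  have hC : 1 ≤ (1 - r)⁻¹ := (one_le_inv₀ h1).2 (by linarith)
  induction N generalizing y with
  | zero =>
    have : 0 ≤ ∑ k, ‖y k‖ ^ 2 := by positivity
    simpa [words, NCBall.mon] using le_mul_of_one_le_left this hC
  | succ N ih =>
    have hnot : ([] : List (Fin d)) ∉
        Finset.univ.biUnion fun j => (words d N).image (List.cons j) := by simp
    rw [words, Finset.sum_insert hnot, Finset.sum_biUnion]
    · have hstep : ∀ j, ∑ α ∈ (words d N).image (List.cons j),
          ∑ k, ‖((Z.mon α).conjTranspose.mulVec y) k‖ ^ 2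
            ≤ (1 - r)⁻¹ * ∑ k, ‖((Z.Z j).conjTranspose.mulVec y) k‖ ^ 2 := fun j => by
        rw [Finset.sum_image (List.cons_injective.injOn)]
        refine le_trans (le_of_eq ?_) (ih ((Z.Z j).conjTranspose.mulVec y))
        refine Finset.sum_congr rfl fun α _ => ?_
        rw [NCBall.mon_cons, Matrix.conjTranspose_mul, Matrix.mulVec_mulVec]
      have h2 := Finset.sum_le_sum fun j (_ : j ∈ Finset.univ) => hstep j
      rw [← Finset.mul_sum] at h2
      have h3 := mul_le_mul_of_nonneg_left (hZ y) (inv_nonneg.2 h1.le)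
      have h4 : ∑ k, ‖((Z.mon []).conjTranspose.mulVec y) k‖ ^ 2 = ∑ k, ‖y k‖ ^ 2 := by
        simp [NCBall.mon]
      rw [h4]
      have h5 : (1 - r)⁻¹ * (r * ∑ k, ‖y k‖ ^ 2) + ∑ k, ‖y k‖ ^ 2
          = (1 - r)⁻¹ * ∑ k, ‖y k‖ ^ 2 := by
        field_simp
        ring
      linarith
    · intro i _ j _ hij
      rw [Function.onFun, Finset.disjoint_left]
      rintro α h1 h2
      obtain ⟨β, -, rfl⟩ := Finset.mem_image.1 h1
      obtain ⟨γ, -, h⟩ := Finset.mem_image.1 h2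
      exact hij (by simpa using (List.cons.inj h).1.symm)

theorem NCBall.memℓp_mon (Z : NCBall d) (i k : Fin Z.n) :
    Memℓp (E := fun _ : List (Fin d) => ℂ) (fun α => Z.mon α i k) 2 := by
  obtain ⟨r, hr0, hr, hZ⟩ := Z.row_bound
  refine memℓp_gen' (C := (1 - r)⁻¹) fun s => ?_
  have hs : s ⊆ words d (s.sup List.length) := fun α hα =>
    mem_words _ _ (Finset.le_sup (f := List.length) hα)
  have h := Z.sum_words_le hr0 hr hZ (s.sup List.length) (Pi.single i 1)
  refine (Finset.sum_le_sum_of_subset_of_nonneg hs fun _ _ _ => by positivity).trans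
    ((Finset.sum_le_sum fun α _ => ?_).trans (h.trans (le_of_eq ?_)))
  · refine le_trans (le_of_eq ?_) (Finset.single_le_sum (fun _ _ => by positivity)
      (Finset.mem_univ k))
    simp [Matrix.conjTranspose_apply]
  · rw [Finset.sum_eq_single i]
    · simp
    · intro b _ hb
      simp [hb]
    · simp

theorem NCPoint.coeff_append (p : NCPoint d) (α β : List (Fin d)) :
    p.coeff (α ++ β) = ∑ k, (∑ i, star (p.y i) * p.mon α i k) * ∑ m, p.mon β k m * p.v m := by
  rw [NCPoint.coeff, NCBall.mon_append, ← Matrix.mulVec_mulVec, Matrix.dotProduct_mulVec]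
  rfl

theorem NCPoint.coeff_eq (p : NCPoint d) (α : List (Fin d)) :
    p.coeff α = ∑ k, (∑ i, star (p.y i) * p.mon α i k) * p.v k := by
  simp only [NCPoint.coeff, Matrix.dotProduct_mulVec]
  simp [dotProduct, Matrix.vecMul]

theorem NCPoint.memℓp_coeff (p : NCPoint d) :
    Memℓp (E := fun _ : List (Fin d) => ℂ) p.coeff 2 := by
  have : p.coeff = ∑ k, p.v k • ∑ i, star (p.y i) • fun α => p.mon α i k := by
    ext α
    simp [NCPoint.coeff_eq, mul_comm]
  rw [this]
  have hs : ∀ {ι : Type} (s : Finset ι) (f : ι → List (Fin d) → ℂ),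
      (∀ i, Memℓp (E := fun _ : List (Fin d) => ℂ) (f i) 2) →
      Memℓp (E := fun _ : List (Fin d) => ℂ) (∑ i ∈ s, f i) 2 := by
    intro ι s f hf
    classical
    induction s using Finset.induction_on with
    | empty => simpa using (zero_memℓp (E := fun _ : List (Fin d) => ℂ) (p := 2))
    | insert a s ha ih =>
      rw [Finset.sum_insert ha]
      exact (hf a).add ih
  refine hs _ _ fun k => Memℓp.const_smul (hs _ _ fun i => Memℓp.const_smul ?_ _) _
  exact p.toNCBall.memℓp_mon i k

/-- The scalar coefficient sequence of a point as an `ℓ²` sequence. -/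
def NCPoint.coeffLp (p : NCPoint d) : FockSpace d ℂ := ⟨p.coeff, p.memℓp_coeff⟩

end Bounds

section KernelVectors

set_option linter.unusedSectionVars false

variable {d : ℕ} {V : Type*} [NormedAddCommGroup V] [InnerProductSpace ℂ V]

theorem norm_sq_eq_tsum (f : FockSpace d V) : ‖f‖ ^ 2 = ∑' α, ‖f α‖ ^ 2 := by
  simpa using lp.norm_rpow_eq_tsum (p := 2) (by norm_num) f

theorem summable_norm_sq (f : FockSpace d V) : Summable fun α => ‖f α‖ ^ 2 := by
  simpa using (lp.memℓp f).summable (p := 2) (by norm_num)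

/-- The kernel vector `K{Z,y,v} ⊗ g = ∑ α, ⟨Z^α v, y⟩ e_α ⊗ g` in the Fock space. -/
def NCPoint.kvec (p : NCPoint d) : V →L[ℂ] FockSpace d V :=
  LinearMap.mkContinuous
    { toFun := fun g => ⟨fun α => star (p.coeff α) • g, by
        have h := summable_norm_sq p.coeffLp
        refine memℓp_gen ?_
        simpa [norm_smul, mul_pow, NCPoint.coeffLp] using h.mul_right (‖g‖ ^ 2)⟩
      map_add' := fun g h => by
        ext α
        show star (p.coeff α) • (g + h) = star (p.coeff α) • g + star (p.coeff α) • h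
        simp
      map_smul' := fun c g => by
        ext α
        show star (p.coeff α) • (c • g) = c • (star (p.coeff α) • g)
        exact smul_comm _ _ _ }
    ‖p.coeffLp‖ fun g => by
      refine (sq_le_sq₀ (norm_nonneg _) (by positivity)).1 ?_
      rw [mul_pow, norm_sq_eq_tsum, norm_sq_eq_tsum, ← tsum_mul_right]
      refine le_of_eq (tsum_congr fun α => ?_)
      show ‖star (p.coeff α) • g‖ ^ 2 = ‖p.coeff α‖ ^ 2 * ‖g‖ ^ 2
      simp [norm_smul, mul_pow]

theorem NCPoint.kvec_apply (p : NCPoint d) (g : V) (α : List (Fin d)) :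
    p.kvec g α = star (p.coeff α) • g := rfl

theorem NCPoint.summable_eval [CompleteSpace V] (p : NCPoint d) (f : FockSpace d V) :
    Summable fun α => p.coeff α • f α := by
  refine .of_norm ?_
  refine .of_nonneg_of_le (fun _ => norm_nonneg _) (fun α => ?_)
    ((summable_norm_sq p.coeffLp).add (summable_norm_sq f))
  rw [norm_smul]
  show ‖p.coeff α‖ * ‖f α‖ ≤ ‖p.coeff α‖ ^ 2 + ‖f α‖ ^ 2
  nlinarith [sq_nonneg (‖p.coeff α‖ - ‖f α‖), sq_nonneg ‖p.coeff α‖, sq_nonneg ‖f α‖]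

theorem NCPoint.inner_kvec [CompleteSpace V] (p : NCPoint d) (g : V) (f : FockSpace d V) :
    ⟪p.kvec g, f⟫_ℂ = ⟪g, p.eval f⟫_ℂ := by
  have h := (p.summable_eval f).hasSum.mapL (innerSL ℂ g)
  rw [lp.inner_eq_tsum, NCPoint.eval]
  refine Eq.trans (tsum_congr fun α => ?_) h.tsum_eq
  simp [NCPoint.kvec_apply, inner_smul_left]

end KernelVectors
section Basis

set_option linter.unusedSectionVars false

variable {d : ℕ} {V : Type*} [NormedAddCommGroup V] [InnerProductSpace ℂ V]

/-- The vector `e_α ⊗ h`. -/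
def basisVec (α : List (Fin d)) (h : V) : FockSpace d V :=
  lp.single (E := fun _ : List (Fin d) => V) 2 α h

theorem basisVec_cons (j : Fin d) (α : List (Fin d)) (h : V) :
    basisVec (j :: α) h = leftShift j (basisVec α h) := by
  ext γ
  rw [leftShift_apply]
  cases γ with
  | nil => simp [basisVec, shiftCoeff]
  | cons i δ =>
    by_cases hi : i = j
    · subst hi
      by_cases hd : δ = α
      · subst hd
        simp [basisVec, shiftCoeff]
      · simp [basisVec, shiftCoeff, hd]
    · simp [basisVec, shiftCoeff, hi]

theorem inner_basisVec_left (α : List (Fin d)) (h : V) (f : FockSpace d V) :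
    ⟪basisVec α h, f⟫_ℂ = ⟪h, f α⟫_ℂ :=
  lp.inner_single_left (𝕜 := ℂ) (G := fun _ : List (Fin d) => V) α h f

theorem adjoint_leftShift_apply [CompleteSpace V] (j : Fin d) (f : FockSpace d V)
    (α : List (Fin d)) :
    adjoint (leftShift j).toContinuousLinearMap f α = f (j :: α) := by
  refine ext_inner_left ℂ fun h => ?_
  rw [← inner_basisVec_left, ContinuousLinearMap.adjoint_inner_right,
    LinearIsometry.coe_toContinuousLinearMap, ← basisVec_cons, inner_basisVec_left]

end Basis

section Positivity

variable {d : ℕ} {H J : Type*}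
  [NormedAddCommGroup H] [InnerProductSpace ℂ H] [CompleteSpace H]
  [NormedAddCommGroup J] [InnerProductSpace ℂ J] [CompleteSpace J]

namespace RightSchur

set_option linter.unusedSectionVars false

variable (A : RightSchur d H J)

theorem op_leftShift (j : Fin d) (f : FockSpace d H) :
    A.op (leftShift j f) = leftShift j (A.op f) := by
  ext γ
  rw [leftShift_apply, A.op_apply]
  cases γ with
  | nil => simp [leftShift_apply, shiftCoeff]
  | cons i δ =>
    rw [Finset.sum_range_succ']
    by_cases h : i = j
    · simp [leftShift_apply, shiftCoeff, h, A.op_apply]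
    · simp [leftShift_apply, shiftCoeff, h]

theorem op_const (h : H) (β : List (Fin d)) : A.op (const h) β = A.coeff β h := by
  rw [A.op_apply, Finset.sum_eq_single 0]
  · simp [const_apply]
  · intro k hk hk0
    have : β.take k ≠ [] := by
      have := Finset.mem_range.1 hk
      intro h0
      rcases List.take_eq_nil_iff.1 h0 with h1 | h1
      · exact hk0 h1
      · subst h1
        simp at this
        exact hk0 this
    rw [const_apply, lp.single_apply_ne _ _ _ this, map_zero]
  · simp

theorem hasSum_inner_basisVec (f : FockSpace d J) (α : List (Fin d)) (h : H) :
    HasSum (fun β => ⟪f (α ++ β), A.coeff β h⟫_ℂ) ⟪f, A.op (basisVec α h)⟫_ℂ := by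
  induction α generalizing f with
  | nil =>
    have := lp.hasSum_inner (𝕜 := ℂ) (G := fun _ : List (Fin d) => J) f (A.op (const h))
    simp only [op_const] at this
    exact this
  | cons j α ih =>
    rw [basisVec_cons, op_leftShift]
    have h1 := ih (adjoint (leftShift j).toContinuousLinearMap f)
    simpa only [ContinuousLinearMap.adjoint_inner_left, adjoint_leftShift_apply,
      LinearIsometry.coe_toContinuousLinearMap, List.cons_append] using h1

theorem sum_norm_coeff_sq_le (s : Finset (List (Fin d))) (h : H) :
    ∑ β ∈ s, ‖A.coeff β h‖ ^ 2 ≤ ‖h‖ ^ 2 := by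
  have h1 := (summable_norm_sq (A.op (const h))).sum_le_tsum s (fun _ _ => by positivity)
  rw [← norm_sq_eq_tsum] at h1
  simp only [op_const] at h1
  refine h1.trans ?_
  have h2 : ‖A.op (const h)‖ ≤ ‖h‖ := by
    refine (A.op.le_of_opNorm_le A.norm_le _).trans ?_
    rw [one_mul, const_apply, lp.norm_single (by norm_num)]
  gcongr

theorem summable_coeff (c : List (Fin d) → ℂ) (hc : Summable fun β => ‖c β‖ ^ 2) :
    Summable fun β => c β • A.coeff β := by
  rw [summable_iff_vanishing_norm]
  intro ε hε
  obtain ⟨s, hs⟩ := (summable_iff_vanishing_norm.1 hc) (ε ^ 2 / 4) (by positivity)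
  refine ⟨s, fun t ht => ?_⟩
  have h1 := hs t ht
  rw [Real.norm_of_nonneg (by positivity)] at h1
  have h2 : ‖∑ β ∈ t, c β • A.coeff β‖ ≤ ε / 2 := by
    refine ContinuousLinearMap.opNorm_le_bound _ (by positivity) fun h => ?_
    have h3 : ‖(∑ β ∈ t, c β • A.coeff β) h‖ ≤ ∑ β ∈ t, ‖c β‖ * ‖A.coeff β h‖ := by
      rw [_root_.sum_apply]
      refine (norm_sum_le _ _).trans (le_of_eq (Finset.sum_congr rfl fun β _ => ?_))
      simp [norm_smul]
    refine h3.trans (abs_le_of_sq_le_sq' ?_ (by positivity)).2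
    refine (Finset.sum_mul_sq_le_sq_mul_sq t _ _).trans ?_
    rw [mul_pow]
    refine mul_le_mul ?_ (A.sum_norm_coeff_sq_le t h) (by positivity) (by positivity)
    nlinarith
  linarith

/-- The operator `(y ⊗ I_J)^* (Z^α ⊗ I_J) A^†(Z) (v ⊗ I_H)`. -/
def row (p : NCPoint d) (α : List (Fin d)) : H →L[ℂ] J :=
  ∑ k, (∑ i, star (p.y i) * p.mon α i k) • ∑ m, p.v m • A.dagger p.toNCBall k m

theorem hasSum_row (p : NCPoint d) (α : List (Fin d)) :
    HasSum (fun β => p.coeff (α ++ β) • A.coeff β) (A.row p α) := by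
  have h1 : ∀ k m, HasSum (fun β => p.mon β k m • A.coeff β) (A.dagger p.toNCBall k m) :=
    fun k m => by
      refine (A.summable_coeff _ ?_).hasSum
      simpa using (p.toNCBall.memℓp_mon k m).summable (by norm_num)
  have h2 := hasSum_sum fun k (_ : k ∈ Finset.univ) =>
    (hasSum_sum fun m (_ : m ∈ Finset.univ) => (h1 k m).const_smul (p.v m)).const_smul
      (∑ i, star (p.y i) * p.mon α i k)
  refine Eq.mp (congrArg (HasSum · _) (funext fun β => ?_)) h2
  rw [NCPoint.coeff_append, Finset.sum_smul]
  refine Finset.sum_congr rfl fun k _ => ?_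
  rw [mul_smul]
  refine congrArg (fun T : H →L[ℂ] J => (∑ i, star (p.y i) * p.mon α i k) • T) ?_
  rw [Finset.sum_smul]
  refine Finset.sum_congr rfl fun m _ => ?_
  rw [smul_smul, mul_comm]

theorem adjoint_op_kvec (p : NCPoint d) (g : J) (α : List (Fin d)) :
    adjoint A.op (p.kvec g) α = adjoint (A.row p α) g := by
  refine ext_inner_right ℂ fun h => ?_
  rw [ContinuousLinearMap.adjoint_inner_left]
  have h1 : ⟪adjoint A.op (p.kvec g) α, h⟫_ℂ = ⟪adjoint A.op (p.kvec g), basisVec α h⟫_ℂ :=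
    (lp.inner_single_right (𝕜 := ℂ) (G := fun _ : List (Fin d) => H) α h _).symm
  rw [h1, ContinuousLinearMap.adjoint_inner_left]
  refine (A.hasSum_inner_basisVec (p.kvec g) α h).unique ?_
  have h2 := ((A.hasSum_row p α).mapL (ContinuousLinearMap.apply ℂ J h)).mapL (innerSL ℂ g)
  simpa [NCPoint.kvec_apply, inner_smul_left, inner_smul_right, mul_comm] using h2

theorem sum_reorder {E : Type*} [AddCommGroup E] [Module ℂ E] {n m : ℕ} (c : Fin n → ℂ)
    (e : Fin m → ℂ) (M : Matrix (Fin n) (Fin n) ℂ) (N : Matrix (Fin m) (Fin m) ℂ)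
    (Q : Matrix (Fin n) (Fin m) E) :
    ∑ i, ∑ j, (c i * e j) • ∑ k, ∑ l, (M i k * star (N j l)) • Q k l =
      ∑ k, ∑ l, ((∑ i, c i * M i k) * ∑ j, e j * star (N j l)) • Q k l := by
  simp only [Finset.smul_sum, Finset.sum_mul_sum, Finset.sum_smul, smul_smul]
  rw [Finset.sum_congr rfl fun i _ => Finset.sum_comm, Finset.sum_comm]
  refine Finset.sum_congr rfl fun k _ => ?_
  rw [Finset.sum_congr rfl fun i _ => Finset.sum_comm, Finset.sum_comm]
  refine Finset.sum_congr rfl fun l _ => Finset.sum_congr rfl fun i _ =>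
    Finset.sum_congr rfl fun j _ => ?_
  rw [mul_mul_mul_comm]

theorem hasSum_szego {E : Type*} [NormedAddCommGroup E] [NormedSpace ℂ E] [CompleteSpace E]
    (Z W : NCBall d) (Q : Matrix (Fin Z.n) (Fin W.n) E) (i : Fin Z.n) (j : Fin W.n) :
    HasSum (fun α => ∑ k, ∑ l, (Z.mon α i k * star (W.mon α j l)) • Q k l) (szego Z W Q i j) := by
  have hs : ∀ k l, Summable fun α => (Z.mon α i k * star (W.mon α j l)) • Q k l := by
    intro k l
    have h1 := (Z.memℓp_mon i k).summable (by norm_num)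
    have h2 := (W.memℓp_mon j l).summable (by norm_num)
    simp only [ENNReal.toReal_ofNat, Real.rpow_ofNat] at h1 h2
    have h3 : Summable fun α => Z.mon α i k * star (W.mon α j l) := by
      refine .of_norm (.of_nonneg_of_le (fun _ => norm_nonneg _) (fun α => ?_) (h1.add h2))
      rw [norm_mul, norm_star]
      nlinarith [sq_nonneg (‖Z.mon α i k‖ - ‖W.mon α j l‖), sq_nonneg ‖Z.mon α i k‖,
        sq_nonneg ‖W.mon α j l‖]
    exact h3.smul_const _
  have hs2 : Summable fun α => ∑ k, ∑ l, (Z.mon α i k * star (W.mon α j l)) • Q k l :=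
    summable_sum fun k _ => summable_sum fun l _ => hs k l
  exact hs2.hasSum

theorem hasSum_szego' {E : Type*} [NormedAddCommGroup E] [NormedSpace ℂ E] [CompleteSpace E]
    (p q : NCPoint d) (Q : Matrix (Fin p.n) (Fin q.n) E) :
    HasSum (fun α => ∑ k, ∑ l, ((∑ i, star (p.y i) * p.mon α i k) *
        star (∑ j, star (q.y j) * q.mon α j l)) • Q k l)
      (∑ i, ∑ j, (star (p.y i) * q.y j) • szego p.toNCBall q.toNCBall Q i j) := by
  have h := hasSum_sum fun i (_ : i ∈ Finset.univ) => hasSum_sum fun j (_ : j ∈ Finset.univ) =>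
    (hasSum_szego p.toNCBall q.toNCBall Q i j).const_smul (star (p.y i) * q.y j)
  simp only [sum_reorder] at h
  simpa using h

theorem inner_gram (p q : NCPoint d) (g f : J) :
    ⟪g, A.gram p q f⟫_ℂ = ⟪p.kvec g, q.kvec f⟫_ℂ -
      ⟪adjoint A.op (p.kvec g), adjoint A.op (q.kvec f)⟫_ℂ := by
  have h1 : HasSum (fun α => p.coeff α * star (q.coeff α)) (∑ i, ∑ j, (star (p.y i) * q.y j) *
      szego p.toNCBall q.toNCBall (Matrix.vecMulVec p.v (star q.v)) i j) := by
    have := hasSum_szego' p q (Matrix.vecMulVec p.v (star q.v))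
    refine Eq.mp (congrArg (HasSum · _) (funext fun α => ?_)) this
    rw [NCPoint.coeff_eq, NCPoint.coeff_eq, star_sum, Finset.sum_mul_sum]
    refine Finset.sum_congr rfl fun k _ => Finset.sum_congr rfl fun l _ => ?_
    simp only [Matrix.vecMulVec_apply, Pi.star_apply, smul_eq_mul, star_mul']
    ring
  have h2 : HasSum (fun α => A.row p α ∘L adjoint (A.row q α))
      (∑ i, ∑ j, (star (p.y i) * q.y j) • szego p.toNCBall q.toNCBall
        (.of fun i j => ∑ k, ∑ l, Matrix.vecMulVec p.v (star q.v) k l •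
          (A.dagger p.toNCBall i k ∘L adjoint (A.dagger q.toNCBall j l))) i j) := by
    have := hasSum_szego' p q (.of fun i j => ∑ k, ∑ l, Matrix.vecMulVec p.v (star q.v) k l •
          (A.dagger p.toNCBall i k ∘L adjoint (A.dagger q.toNCBall j l)))
    refine Eq.mp (congrArg (HasSum · _) (funext fun α => ?_)) this
    have hB : ∀ k l, (∑ m, ∑ m', Matrix.vecMulVec p.v (star q.v) m m' •
        (A.dagger p.toNCBall k m ∘L adjoint (A.dagger q.toNCBall l m'))) =
        (∑ m, p.v m • A.dagger p.toNCBall k m) ∘L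
          adjoint (∑ m, q.v m • A.dagger q.toNCBall l m) := fun k l => by
      rw [map_sum, ContinuousLinearMap.finsetSum_comp]
      refine Finset.sum_congr rfl fun m _ => ?_
      rw [ContinuousLinearMap.comp_finsetSum]
      refine Finset.sum_congr rfl fun m' _ => ?_
      rw [map_smulₛₗ, ContinuousLinearMap.comp_smul, ContinuousLinearMap.smul_comp, smul_smul,
        Matrix.vecMulVec_apply, mul_comm]
      rfl
    simp only [Matrix.of_apply, hB]
    rw [row, row, map_sum, ContinuousLinearMap.finsetSum_comp]
    refine Finset.sum_congr rfl fun k _ => ?_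
    rw [ContinuousLinearMap.comp_finsetSum]
    refine Finset.sum_congr rfl fun l _ => ?_
    rw [map_smulₛₗ, ContinuousLinearMap.comp_smul, ContinuousLinearMap.smul_comp, smul_smul,
      mul_comm]
    rfl
  have h3 : A.gram p q = (∑ i, ∑ j, (star (p.y i) * q.y j) *
      szego p.toNCBall q.toNCBall (Matrix.vecMulVec p.v (star q.v)) i j) •
        ContinuousLinearMap.id ℂ J - (∑ i, ∑ j, (star (p.y i) * q.y j) •
        szego p.toNCBall q.toNCBall (.of fun i j => ∑ k, ∑ l,
          Matrix.vecMulVec p.v (star q.v) k l •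
          (A.dagger p.toNCBall i k ∘L adjoint (A.dagger q.toNCBall j l))) i j) := by
    simp only [gram, ncKernel, Matrix.of_apply, Matrix.sub_apply, smul_sub,
      Finset.sum_sub_distrib, Finset.sum_smul, smul_smul]
  rw [h3, ← h1.tsum_eq, ← h2.tsum_eq, _root_.sub_apply, inner_sub_right]
  congr 1
  · rw [_root_.smul_apply, ContinuousLinearMap.id_apply, inner_smul_right,
      lp.inner_eq_tsum, ← tsum_mul_right]
    refine tsum_congr fun α => ?_
    simp only [NCPoint.kvec_apply, inner_smul_left, inner_smul_right]
    simp [mul_assoc, mul_left_comm]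
  · have h4 := (h2.summable.hasSum.mapL (ContinuousLinearMap.apply ℂ J f)).mapL (innerSL ℂ g)
    rw [lp.inner_eq_tsum]
    refine Eq.trans h4.tsum_eq.symm (tsum_congr fun α => ?_)
    rw [adjoint_op_kvec, adjoint_op_kvec]
    simp [ContinuousLinearMap.adjoint_inner_left]

theorem gram_eq (p q : NCPoint d) : A.gram p q =
    adjoint p.kvec ∘L (ContinuousLinearMap.id ℂ _ - A.op ∘L adjoint A.op) ∘L q.kvec := by
  ext f
  refine ext_inner_left ℂ fun g => ?_
  rw [inner_gram]
  simp only [ContinuousLinearMap.comp_apply, ContinuousLinearMap.adjoint_inner_right,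
    _root_.sub_apply, ContinuousLinearMap.id_apply, inner_sub_right]
  rw [← ContinuousLinearMap.adjoint_inner_right A.op,
    ← ContinuousLinearMap.adjoint_inner_left A.op]

theorem norm_adjoint_op_le (u : FockSpace d J) : ‖adjoint A.op u‖ ≤ ‖u‖ := by
  have h : ‖adjoint A.op‖ ≤ 1 := by
    rw [LinearIsometryEquiv.norm_map]
    exact A.norm_le
  simpa using (adjoint A.op).le_of_opNorm_le h u

theorem gram_posSemidef : A.gram.PosSemidef := by
  have key : A.gram.PosSemidef ↔ (A.gram.IsHermitian ∧ ∀ vv : NCPoint d →₀ J,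
      0 ≤ RCLike.re (vv.sum fun x w => vv.sum fun x' w' => ⟪A.gram x' x w, w'⟫_ℂ)) :=
    RKHS.posSemidef_tfae.out 0 2
  refine key.2 ⟨?_, fun vv => ?_⟩
  · ext1 p q
    rw [Matrix.conjTranspose_apply, gram_eq, gram_eq, ContinuousLinearMap.star_eq_adjoint]
    simp [ContinuousLinearMap.adjoint_comp, ContinuousLinearMap.comp_assoc]
  · set u : FockSpace d J := vv.sum fun x w => x.kvec w with hu
    have h : (vv.sum fun x w => vv.sum fun x' w' => ⟪A.gram x' x w, w'⟫_ℂ) =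
        ⟪u, u⟫_ℂ - ⟪adjoint A.op u, adjoint A.op u⟫_ℂ := by
      have h1 : ∀ x x' w w', ⟪A.gram x' x w, w'⟫_ℂ = ⟪x.kvec w, x'.kvec w'⟫_ℂ -
          ⟪adjoint A.op (x.kvec w), adjoint A.op (x'.kvec w')⟫_ℂ := fun x x' w w' => by
        rw [← inner_conj_symm, inner_gram, map_sub, inner_conj_symm, inner_conj_symm]
      simp only [h1, hu, Finsupp.sum, map_sum, sum_inner, inner_sum, Finset.sum_sub_distrib]
      congr 1 <;> exact Finset.sum_comm
    rw [h, inner_self_eq_norm_sq_to_K, inner_self_eq_norm_sq_to_K]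
    have := A.norm_adjoint_op_le u
    have h2 := pow_le_pow_left₀ (norm_nonneg _) this 2
    norm_cast
    simpa using h2

end RightSchur
end Positivity

section Space

variable {d : ℕ} {H J : Type*}
  [NormedAddCommGroup H] [InnerProductSpace ℂ H] [CompleteSpace H]
  [NormedAddCommGroup J] [InnerProductSpace ℂ J] [CompleteSpace J]

instance (A : RightSchur d H J) : Fact A.gram.PosSemidef := ⟨A.gram_posSemidef⟩

/-- The right free de Branges-Rovnyak space `ℋ^R(A)`: the reproducing kernel Hilbert space of the
kernel `K^A`, that is, the completion of the span of the vectors `K^A{Z,y,v} g`. -/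
def RightSchur.dbr (A : RightSchur d H J) : Type _ := RKHS.OfKernel A.gram

namespace RightSchur

variable (A : RightSchur d H J)

instance : NormedAddCommGroup A.dbr :=
  inferInstanceAs (NormedAddCommGroup (RKHS.OfKernel A.gram))

instance : InnerProductSpace ℂ A.dbr :=
  inferInstanceAs (InnerProductSpace ℂ (RKHS.OfKernel A.gram))

instance : CompleteSpace A.dbr :=
  inferInstanceAs (CompleteSpace (RKHS.OfKernel A.gram))

/-- Elements of `ℋ^R(A)` are functions of `{Z, y, v}`. -/
instance : RKHS ℂ A.dbr (NCPoint d) J :=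
  inferInstanceAs (RKHS ℂ (RKHS.OfKernel A.gram) (NCPoint d) J)

theorem kernel_dbr : RKHS.kernel A.dbr = A.gram := RKHS.OfKernel.kernel_ofKernel

/-- The linear map from `⨁ J` to `ℋ^R(A)` with dense range given by the kernel functions. -/
def kerSum : (NCPoint d × J →₀ ℂ) →ₗ[ℂ] A.dbr :=
  Finsupp.linearCombination ℂ fun x => RKHS.kerFun A.dbr x.1 x.2

/-- The same combination of kernel vectors in the Fock space. -/
def fockSum : (NCPoint d × J →₀ ℂ) →ₗ[ℂ] FockSpace d J :=
  Finsupp.linearCombination ℂ fun x => x.1.kvec x.2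

theorem norm_kerSum (u : NCPoint d × J →₀ ℂ) :
    ‖A.kerSum u‖ ^ 2 + ‖adjoint A.op (fockSum u)‖ ^ 2 = ‖(fockSum u : FockSpace d J)‖ ^ 2 := by
  have h : ⟪A.kerSum u, A.kerSum u⟫_ℂ = ⟪(fockSum u : FockSpace d J), fockSum u⟫_ℂ -
      ⟪adjoint A.op (fockSum u), adjoint A.op (fockSum u)⟫_ℂ := by
    have h1 : ∀ x x' : NCPoint d × J,
        ⟪RKHS.kerFun A.dbr x.1 x.2, RKHS.kerFun A.dbr x'.1 x'.2⟫_ℂ =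
        ⟪x.1.kvec x.2, x'.1.kvec x'.2⟫_ℂ -
          ⟪adjoint A.op (x.1.kvec x.2), adjoint A.op (x'.1.kvec x'.2)⟫_ℂ := fun x x' => by
      rw [RKHS.kerFun_inner, RKHS.kerFun_apply, kernel_dbr, inner_gram]
    simp only [kerSum, fockSum, Finsupp.linearCombination_apply, Finsupp.sum, map_sum, map_smul,
      sum_inner, inner_sum, inner_smul_left, inner_smul_right, h1, mul_sub,
      Finset.sum_sub_distrib]
  rw [inner_self_eq_norm_sq_to_K, inner_self_eq_norm_sq_to_K, inner_self_eq_norm_sq_to_K] at h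
  norm_cast at h
  linarith

theorem denseRange_kerSum : DenseRange A.kerSum := by
  have h := RKHS.kerFun_dense A.dbr
  have h2 : Set.range A.kerSum = (LinearMap.range A.kerSum : Set A.dbr) := rfl
  rw [DenseRange, h2, ← Submodule.dense_iff_topologicalClosure_eq_top.symm.eq, kerSum,
    Finsupp.range_linearCombination, ← h]
  congr 2
  ext f
  simp

/-- The Fock space vector `I ⊗ g + ∑ j, L_j u_j`. -/
def colVec (g : J) (u : Fin d → FockSpace d J) : FockSpace d J :=
  const g + ∑ j, leftShift j (u j)

theorem norm_colVec {V : Type*} [NormedAddCommGroup V] [InnerProductSpace ℂ V]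
    (g : V) (u : Fin d → FockSpace d V) :
    ‖colVec g u‖ ^ 2 = ‖g‖ ^ 2 + ∑ j, ‖u j‖ ^ 2 := by
  have h0 : ∀ j, ⟪(const g : FockSpace d V), leftShift j (u j)⟫_ℂ = 0 := fun j => by
    have := inner_basisVec_left [] g (leftShift j (u j))
    rw [leftShift_apply] at this
    exact this.trans (by simp [shiftCoeff])
  have h1 : ‖(const g : FockSpace d V)‖ = ‖g‖ := by
    rw [const_apply, lp.norm_single (by norm_num)]
  have h2 : ‖∑ j, leftShift j (u j)‖ ^ 2 = ∑ j, ‖u j‖ ^ 2 := by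
    have : ⟪∑ j, leftShift j (u j), ∑ j, leftShift j (u j)⟫_ℂ = ∑ j, ⟪u j, u j⟫_ℂ := by
      rw [sum_inner]
      simp only [inner_sum, inner_leftShift]
      simp
    simp only [inner_self_eq_norm_sq_to_K] at this
    exact_mod_cast this
  rw [colVec, norm_add_sq (𝕜 := ℂ), h1, h2, inner_sum]
  simp [h0]

theorem bessel (x : FockSpace d H) :
    ‖x []‖ ^ 2 + ∑ j, ‖adjoint (leftShift j).toContinuousLinearMap x‖ ^ 2 ≤ ‖x‖ ^ 2 := by
  set u : Fin d → FockSpace d H := fun j => adjoint (leftShift j).toContinuousLinearMap x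
  have h1 := norm_colVec (x []) u
  have h2 : ⟪colVec (x []) u, x⟫_ℂ = (‖x []‖ ^ 2 + ∑ j, ‖u j‖ ^ 2 : ℝ) := by
    have ha : ⟪(const (x []) : FockSpace d H), x⟫_ℂ = ⟪x [], x []⟫_ℂ :=
      inner_basisVec_left [] (x []) x
    have hb : ∀ j, ⟪leftShift j (u j), x⟫_ℂ = ⟪u j, u j⟫_ℂ := fun j => by
      rw [ContinuousLinearMap.adjoint_inner_right]
      rfl
    rw [colVec, inner_add_left, sum_inner, ha]
    simp only [hb, inner_self_eq_norm_sq_to_K]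
    push_cast
    rfl
  have h3 : ‖x []‖ ^ 2 + ∑ j, ‖u j‖ ^ 2 ≤ ‖colVec (x []) u‖ * ‖x‖ := by
    refine le_trans ?_ (norm_inner_le_norm (𝕜 := ℂ) _ _)
    rw [h2, Complex.norm_real]
    exact le_abs_self _
  rw [← h1] at h3 ⊢
  by_cases h0 : ‖colVec (x []) u‖ = 0
  · rw [h0, zero_pow two_ne_zero]; positivity
  · have : ‖colVec (x []) u‖ ≤ ‖x‖ := by
      have hp : 0 < ‖colVec (x []) u‖ := lt_of_le_of_ne (norm_nonneg _) (Ne.symm h0)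
      nlinarith
    gcongr

/-- The vacuum component of `A(R)^* (I ⊗ g + ∑ j, L_j u_j)` is controlled by `g` and the defect
of `u`. -/
theorem norm_vacuum_le (g : J) (u : Fin d → FockSpace d J) :
    ‖adjoint A.op (colVec g u) []‖ ^ 2 + ∑ j, ‖adjoint A.op (u j)‖ ^ 2
      ≤ ‖g‖ ^ 2 + ∑ j, ‖u j‖ ^ 2 := by
  have h1 := bessel (adjoint A.op (colVec g u))
  have h2 : ∀ j, adjoint (leftShift j).toContinuousLinearMap (adjoint A.op (colVec g u)) =
      adjoint A.op (u j) := fun j => by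
    refine ext_inner_right ℂ fun x => ?_
    rw [ContinuousLinearMap.adjoint_inner_left, ContinuousLinearMap.adjoint_inner_left,
      ContinuousLinearMap.adjoint_inner_left, LinearIsometry.coe_toContinuousLinearMap,
      op_leftShift, colVec, inner_add_left, sum_inner]
    have h0 : ⟪(const g : FockSpace d J), leftShift j (A.op x)⟫_ℂ = 0 := by
      have := inner_basisVec_left [] g (leftShift j (A.op x))
      rw [leftShift_apply] at this
      exact this.trans (by simp [shiftCoeff])
    simp [h0, inner_leftShift]
  simp only [h2] at h1
  refine h1.trans ?_
  rw [← norm_colVec]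
  exact pow_le_pow_left₀ (norm_nonneg _) (A.norm_adjoint_op_le _) 2

theorem exists_column {K S : Type*} [NormedAddCommGroup K] [InnerProductSpace ℂ K]
    [CompleteSpace K] [AddCommGroup S] [Module ℂ S] (κ : S →ₗ[ℂ] K) (hκ : DenseRange κ)
    (Y : J × (Fin d → S) →ₗ[ℂ] H)
    (hY : ∀ g u, ‖Y (g, u)‖ ^ 2 ≤ ‖g‖ ^ 2 + ∑ j, ‖κ (u j)‖ ^ 2) :
    ∃ (T₀ : H →L[ℂ] J) (T : H →L[ℂ] PiLp 2 (fun _ : Fin d => K)),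
      (∀ h g, ⟪Y (g, 0), h⟫_ℂ = ⟪g, T₀ h⟫_ℂ) ∧
      (∀ h j s, ⟪Y (0, Pi.single j s), h⟫_ℂ = ⟪κ s, T h j⟫_ℂ) ∧
      ∀ h, ‖T₀ h‖ ^ 2 + ‖T h‖ ^ 2 ≤ ‖h‖ ^ 2 := by
  let E := WithLp 2 (J × PiLp 2 (fun _ : Fin d => K))
  let c : (J × (Fin d → K)) ≃L[ℂ] E :=
    ((ContinuousLinearEquiv.refl ℂ J).prodCongr
      (PiLp.continuousLinearEquiv 2 ℂ (fun _ : Fin d => K)).symm).trans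
      (WithLp.prodContinuousLinearEquiv 2 ℂ J (PiLp 2 (fun _ : Fin d => K))).symm
  let e : J × (Fin d → S) →ₗ[ℂ] E :=
    (c : (J × (Fin d → K)) →ₗ[ℂ] E) ∘ₗ
      LinearMap.prodMap LinearMap.id (LinearMap.pi fun j => κ ∘ₗ LinearMap.proj j)
  have hnorm : ∀ g u, ‖e (g, u)‖ ^ 2 = ‖g‖ ^ 2 + ∑ j, ‖κ (u j)‖ ^ 2 := fun g u => by
    rw [WithLp.prod_norm_sq_eq_of_L2, PiLp.norm_sq_eq_of_L2]
    rfl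
  have hinner : ∀ g u (x : E), ⟪e (g, u), x⟫_ℂ = ⟪g, x.fst⟫_ℂ + ∑ j, ⟪κ (u j), x.snd j⟫_ℂ :=
    fun g u x => by
      rw [WithLp.prod_inner_apply, PiLp.inner_apply]
      rfl
  have he : DenseRange e := by
    refine c.surjective.denseRange.comp ?_ c.continuous
    exact Function.surjective_id.denseRange.prodMap (DenseRange.piMap fun _ : Fin d => hκ)
  have hb : ∀ x, ‖Y x‖ ≤ 1 * ‖e x‖ := fun x => by
    rw [one_mul]
    refine (sq_le_sq₀ (norm_nonneg _) (norm_nonneg _)).1 ?_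
    rw [← Prod.mk.eta (p := x), hnorm]
    exact hY _ _
  let R : E →L[ℂ] H := Y.extendOfNorm e
  have hR : ∀ x, R (e x) = Y x := LinearMap.extendOfNorm_eq he ⟨1, hb⟩
  have hR1 : ‖R‖ ≤ 1 := LinearMap.opNorm_extendOfNorm_le he zero_le_one hb
  refine ⟨WithLp.fstL 2 ℂ J (PiLp 2 (fun _ : Fin d => K)) ∘L adjoint R,
    WithLp.sndL 2 ℂ J (PiLp 2 (fun _ : Fin d => K)) ∘L adjoint R, fun h g => ?_,
    fun h j s => ?_, fun h => ?_⟩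
  · rw [← hR, ← ContinuousLinearMap.adjoint_inner_right, hinner]
    simp
  · rw [← hR, ← ContinuousLinearMap.adjoint_inner_right, hinner, inner_zero_left, zero_add,
      Finset.sum_eq_single j]
    · rw [Pi.single_eq_same]
      rfl
    · intro i _ hi
      rw [Pi.single_eq_of_ne hi, map_zero, inner_zero_left]
    · simp
  · have h1 : ‖adjoint R‖ ≤ 1 := by
      rw [LinearIsometryEquiv.norm_map]
      exact hR1
    have h2 := pow_le_pow_left₀ (norm_nonneg _) ((adjoint R).le_of_opNorm_le h1 h) 2
    rw [WithLp.prod_norm_sq_eq_of_L2, one_mul] at h2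
    exact h2

/-- Existence of the Gleason solution `𝐀 = (L^* ⊗ I_J) A` with values in `ℋ^R(A) ⊗ ℂ^d`, and its
contractivity. -/
theorem exists_gleason : ∃ T : H →L[ℂ] PiLp 2 (fun _ : Fin d => A.dbr),
    (∀ h j p, T h j p = p.eval (adjoint (leftShift j).toContinuousLinearMap (A.op (const h)))) ∧
    ∀ h, ‖A.zeroVal h‖ ^ 2 + ‖T h‖ ^ 2 ≤ ‖h‖ ^ 2 := by
  let col : J × (Fin d → (NCPoint d × J →₀ ℂ)) →ₗ[ℂ] FockSpace d J :=
    { toFun := fun x => colVec x.1 fun j => fockSum (x.2 j)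
      map_add' := fun x y => by
        simp [colVec, Finset.sum_add_distrib]
        abel
      map_smul' := fun a x => by
        simp [colVec, Finset.smul_sum] }
  have hc : ∀ x : FockSpace d H, ∀ h, ⟪x, const h⟫_ℂ = ⟪x [], h⟫_ℂ := fun x h =>
    lp.inner_single_right (𝕜 := ℂ) (G := fun _ : List (Fin d) => H) [] h x
  let vac : FockSpace d H →ₗ[ℂ] H :=
    { toFun := fun x => x [], map_add' := fun _ _ => rfl, map_smul' := fun _ _ => rfl }
  let Y : J × (Fin d → (NCPoint d × J →₀ ℂ)) →ₗ[ℂ] H :=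
    vac ∘ₗ (adjoint A.op : FockSpace d J →ₗ[ℂ] FockSpace d H) ∘ₗ col
  have hY : ∀ x h, ⟪Y x, h⟫_ℂ = ⟪colVec x.1 (fun j => fockSum (x.2 j)), A.op (const h)⟫_ℂ :=
    fun x h => by
      rw [← ContinuousLinearMap.adjoint_inner_left, hc]
      rfl
  obtain ⟨T₀, T, h0, h1, h2⟩ := exists_column A.kerSum A.denseRange_kerSum Y fun g u => by
    have := A.norm_vacuum_le g fun j => fockSum (u j)
    have h3 : ∑ j, ‖(fockSum (u j) : FockSpace d J)‖ ^ 2 =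
        ∑ j, ‖A.kerSum (u j)‖ ^ 2 + ∑ j, ‖adjoint A.op (fockSum (u j))‖ ^ 2 := by
      rw [← Finset.sum_add_distrib]
      exact Finset.sum_congr rfl fun j _ => (A.norm_kerSum (u j)).symm
    rw [h3] at this
    have h4 : ‖Y (g, u)‖ = ‖adjoint A.op (colVec g fun j => fockSum (u j)) []‖ := rfl
    rw [h4]
    linarith
  have hT₀ : ∀ h, T₀ h = A.zeroVal h := fun h => by
    refine ext_inner_left ℂ fun g => ?_
    rw [← h0, hY]
    have : colVec g (fun j => fockSum ((0 : Fin d → (NCPoint d × J →₀ ℂ)) j)) = const g := by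
      simp [colVec]
    rw [this]
    exact (inner_basisVec_left [] g _).trans (by rw [op_const]; rfl)
  refine ⟨T, fun h j p => ?_, fun h => by rw [← hT₀]; exact h2 h⟩
  refine ext_inner_left ℂ fun g => ?_
  have h3 := h1 h j (Finsupp.single (p, g) 1)
  have hk : A.kerSum (Finsupp.single (p, g) 1) = RKHS.kerFun A.dbr p g := by simp [kerSum]
  rw [hk, RKHS.kerFun_inner, hY] at h3
  rw [← h3, ← NCPoint.inner_kvec, ContinuousLinearMap.adjoint_inner_right]
  have hf : ∀ i, (fockSum ((Pi.single j (Finsupp.single (p, g) 1) :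
      Fin d → (NCPoint d × J →₀ ℂ)) i) : FockSpace d J) =
      if i = j then p.kvec g else 0 := fun i => by
    by_cases hi : i = j
    · subst hi
      simp [fockSum]
    · simp [hi]
  simp only [colVec, hf]
  rw [map_zero, zero_add, Finset.sum_eq_single j, if_pos rfl]
  · rfl
  · intro i _ hi
    rw [if_neg hi, map_zero]
  · simp

/-- The contractive Gleason solution `𝐀 = (L^* ⊗ I_J) A : H → ℋ^R(A) ⊗ ℂ^d`; here
`ℋ^R(A) ⊗ ℂ^d` is the `ℓ²` direct sum of `d` copies of `ℋ^R(A)`. -/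
def gleason : H →L[ℂ] PiLp 2 (fun _ : Fin d => A.dbr) := A.exists_gleason.choose

/-- The `j`-th component of `𝐀 h` is the function `L_j^* (A h)`; this determines `𝐀`. -/
theorem gleason_apply (h : H) (j : Fin d) (p : NCPoint d) : A.gleason h j p =
    p.eval (adjoint (leftShift j).toContinuousLinearMap (A.op (const h))) :=
  A.exists_gleason.choose_spec.1 h j p

/-- The defect operator `I - A(0)^* A(0)`. -/
def defectZero : H →L[ℂ] H := ContinuousLinearMap.id ℂ H - adjoint A.zeroVal ∘L A.zeroVal

/-- `𝐀^* 𝐀`. -/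
def gleasonSq : H →L[ℂ] H := adjoint A.gleason ∘L A.gleason

theorem defect_nonneg : 0 ≤ A.defectZero - A.gleasonSq := by
  rw [ContinuousLinearMap.nonneg_iff_isPositive, ContinuousLinearMap.isPositive_iff_complex]
  intro h
  have h1 : ⟪(A.defectZero - A.gleasonSq) h, h⟫_ℂ =
      ((‖h‖ ^ 2 - ‖A.zeroVal h‖ ^ 2 - ‖A.gleason h‖ ^ 2 : ℝ) : ℂ) := by
    simp only [defectZero, gleasonSq, _root_.sub_apply, inner_sub_left,
      ContinuousLinearMap.comp_apply, ContinuousLinearMap.id_apply]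
    rw [ContinuousLinearMap.adjoint_inner_left, ContinuousLinearMap.adjoint_inner_left,
      inner_self_eq_norm_sq_to_K, inner_self_eq_norm_sq_to_K, inner_self_eq_norm_sq_to_K]
    push_cast
    rfl
  rw [h1]
  have h2 := A.exists_gleason.choose_spec.2 h
  refine ⟨congrArg _ (Complex.ofReal_re _), ?_⟩
  have h3 : ‖A.gleason h‖ = ‖A.exists_gleason.choose h‖ := rfl
  simp only [RCLike.re_to_complex, Complex.ofReal_re]
  rw [h3]
  linarith

/-- The positive operator `a_∅` with `a_∅² = I - A(0)^* A(0) - 𝐀^* 𝐀`. -/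
def aEmpty : H →L[ℂ] H := CFC.sqrt (A.defectZero - A.gleasonSq)

theorem aEmpty_nonneg : 0 ≤ A.aEmpty := CFC.sqrt_nonneg _

theorem aEmpty_mul_self : A.aEmpty * A.aEmpty = A.defectZero - A.gleasonSq :=
  CFC.sqrt_mul_sqrt_self _ A.defect_nonneg

/-- `ℋ^R(A)` is `L`-invariant: `Z_j F(Z)` belongs to `ℋ^R(A)` for every `F` in `ℋ^R(A)` and every
`j`. -/
def LeftInvariant : Prop :=
  ∀ (j : Fin d) (F : A.dbr), ∃ G : A.dbr, ∀ p : NCPoint d, G p = F (p.mulLeft j)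

theorem eval_smul (c : ℂ) (p : NCPoint d) (f : FockSpace d J) :
    p.eval (c • f) = c • p.eval f := by
  refine ext_inner_left ℂ fun g => ?_
  rw [← NCPoint.inner_kvec, inner_smul_right, inner_smul_right, NCPoint.inner_kvec]

theorem eval_add (p : NCPoint d) (f f' : FockSpace d J) :
    p.eval (f + f') = p.eval f + p.eval f' := by
  refine ext_inner_left ℂ fun g => ?_
  rw [← NCPoint.inner_kvec, inner_add_right, inner_add_right, NCPoint.inner_kvec,
    NCPoint.inner_kvec]

/-- The operator `Â` with domain `{h : A h ∈ ℋ^R(A)}` and `Â h = A h`, where `A h` is the function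
`A^†(Z) h`. -/
def hat : H →ₗ.[ℂ] A.dbr where
  domain :=
    { carrier := {h | ∃ F : A.dbr, ∀ p : NCPoint d, F p = p.eval (A.op (const h))}
      zero_mem' := ⟨0, fun p => by simp [NCPoint.eval]⟩
      add_mem' := by
        rintro h h' ⟨F, hF⟩ ⟨F', hF'⟩
        exact ⟨F + F', fun p => by simp [hF, hF', eval_add]⟩
      smul_mem' := by
        rintro c h ⟨F, hF⟩
        exact ⟨c • F, fun p => by simp [hF, eval_smul]⟩ }
  toFun :=
    { toFun := fun h => h.2.choose
      map_add' := fun h h' => by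
        refine RKHS.ext fun p => ?_
        rw [(h + h').2.choose_spec p, RKHS.coe_add, Pi.add_apply, h.2.choose_spec p,
          h'.2.choose_spec p, ← eval_add]
        simp
      map_smul' := fun c h => by
        refine RKHS.ext fun p => ?_
        rw [(c • h).2.choose_spec p, RingHom.id_apply, RKHS.coe_smul, Pi.smul_apply,
          h.2.choose_spec p, ← eval_smul]
        simp }

theorem hat_apply (h : A.hat.domain) (p : NCPoint d) :
    A.hat h p = p.eval (A.op (const (h : H))) := h.2.choose_spec p

end RightSchur
end Space

/-- `T = (I + S^* S)^{-1}`: the graph of the bounded operator `T` is the inverse of the graph of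
`I + S^* S`, whose domain consists of the `x ∈ Dom S` with `S x ∈ Dom S^*`. -/
def IsInvOneAddStarMul {H K : Type*} [NormedAddCommGroup H] [InnerProductSpace ℂ H]
    [CompleteSpace H] [NormedAddCommGroup K] [InnerProductSpace ℂ K]
    (S : H →ₗ.[ℂ] K) (T : H →L[ℂ] H) : Prop :=
  ∀ x y : H, T y = x ↔
    ∃ (hx : x ∈ S.domain) (hSx : S ⟨x, hx⟩ ∈ S.adjoint.domain), x + S.adjoint ⟨_, hSx⟩ = y

end FreeDBR

end

noncomputable section

namespace FreeDBR

open scoped ENNReal InnerProductSpace ComplexOrder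
open ContinuousLinearMap (adjoint)

set_option linter.unusedSectionVars false

/-! ### Range inclusion and majorization -/

section Majorization

variable {E F G : Type*}
  [NormedAddCommGroup E] [InnerProductSpace ℂ E] [CompleteSpace E]
  [NormedAddCommGroup F] [InnerProductSpace ℂ F] [CompleteSpace F]
  [NormedAddCommGroup G] [InnerProductSpace ℂ G] [CompleteSpace G]

/-! Everything is read off from one contraction, `column`, here written `V h = (A(0) h, 𝐀 h)`, from
`H` into `J ⊕ (ℋ^R(A) ⊗ ℂ^d)`, and from its two defect operators. By construction `a_∅² = I - V^*
V`, so `a = a_∅` is a defect operator of `V`.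

The other defect carries the function theory. The map `colFock`, `(g, F) ↦ I ⊗ g + ∑ j, L_j F_j`,
embeds the target of `V` in the Fock space and sends `V h` to `A h`. Because the backward shifts
commute with `A(R)^*`, the space `ℋ^R(A)` itself provides an operator `Y` (`colDefect`) with `Y^* Y
= I - V V^*`, and the inclusion of `ℋ^R(A)` in the Fock space is `colFock` after `Y^*`
(`isDefect_colDefect`, `colFock_adjoint_colDefect`). Hence `colFock x` lies in `ℋ^R(A)` exactly when
`x` lies in the range of `Y^*`.

So `A h ∈ ℋ^R(A)` means `V h ∈ ran Y^*`, and for any contraction this is equivalent to `h ∈ ran a^*`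
(`IsDefect.exists_adjoint_eq_iff`); this identifies `Dom Â` with `ran a_∅`. Shift invariance means
that `ran Y^*` contains all `(0, F)`. By Douglas' range inclusion theorem (`range_adjoint_le_iff`)
this is a bound of the second coordinate of `z` by `‖Y z‖`, which transfers to a bound of `‖𝐀 x‖` by
`‖a x‖` (`IsDefect.exists_bound_iff`). Douglas' theorem again turns it into `ran 𝐀^* ⊆ ran a`, and
`‖a x‖² = ‖x‖² - ‖A(0) x‖² - ‖𝐀 x‖²` turns it into the inequality with `ρ`.

For the last condition, `Y^* Â h = V h` and `Â a² y = Y V y` give `⟨Â a² y, Â h⟩ = ⟨V y, V h⟩ = ⟨y -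
a² y, h⟩`, so `a²` is the inverse of `I + Â^* Â` once `Â` is densely defined
(`isInvOneAddStarMul_hat`). The operator inequality is then the previous one with `ρ = 1 - r`.
Purity of `A(0)` serves only to make `a` injective, hence `Dom Â = ran a` dense. -/

theorem exists_adjoint_eq_of_norm_inner_le (B : E →L[ℂ] F) (y : E) (C : ℝ)
    (h : ∀ x, ‖⟪y, x⟫_ℂ‖ ≤ C * ‖B x‖) : ∃ z, adjoint B z = y := by
  let N := (LinearMap.range (B : E →ₗ[ℂ] F)).topologicalClosure
  let e : E →ₗ[ℂ] N := (B : E →ₗ[ℂ] F).codRestrict N fun x =>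
    Submodule.le_topologicalClosure _ ⟨x, rfl⟩
  have he : DenseRange e := by
    intro z
    rw [closure_subtype]
    have h1 : ((↑) '' Set.range e : Set F) = Set.range B := by
      rw [← Set.range_comp]
      rfl
    rw [h1]
    exact z.2
  have hC : ∀ x, ‖(innerSL ℂ y : E →ₗ[ℂ] ℂ) x‖ ≤ C * ‖e x‖ := h
  -- The rule `B x ↦ ⟨y, x⟩` is well defined and bounded by hypothesis. Its Riesz vector on the
  -- closure of `ran B` is the required preimage.
  let φ : N →L[ℂ] ℂ := (innerSL ℂ y : E →ₗ[ℂ] ℂ).extendOfNorm e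
  have hφ : ∀ x, φ (e x) = ⟪y, x⟫_ℂ := LinearMap.extendOfNorm_eq he ⟨C, hC⟩
  have : CompleteSpace N := (Submodule.isClosed_topologicalClosure _).completeSpace_coe
  let z := (InnerProductSpace.toDual ℂ N).symm φ
  refine ⟨(z : F), ext_inner_right ℂ fun x => ?_⟩
  rw [ContinuousLinearMap.adjoint_inner_left, ← hφ]
  have := InnerProductSpace.toDual_symm_apply (𝕜 := ℂ) (x := e x) (y := φ)
  rw [← this]
  rfl

theorem norm_inner_adjoint_le (B : E →L[ℂ] F) (z : F) (x : E) :
    ‖⟪adjoint B z, x⟫_ℂ‖ ≤ ‖z‖ * ‖B x‖ := by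
  rw [ContinuousLinearMap.adjoint_inner_left]
  exact norm_inner_le_norm _ _

/-- Uniform boundedness over the possibly unbounded set `{x | ‖B x‖ ≤ 1}`: a preimage `z` of `D^* k`
under `B^*` bounds `⟨D x, k⟩ = ⟨B x, z⟩` there by `‖z‖`. No closed graph argument is needed. -/
theorem exists_bound_of_range_adjoint_le (B : E →L[ℂ] F) (D : E →L[ℂ] G)
    (h : ∀ k, ∃ z, adjoint B z = adjoint D k) : ∃ C : ℝ, 0 < C ∧ ∀ x, ‖D x‖ ≤ C * ‖B x‖ := by
  obtain ⟨C, hC⟩ := banach_steinhaus (𝕜 := ℂ) (𝕜₂ := ℂ)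
    (g := fun x : {x : E // ‖B x‖ ≤ 1} => innerSL ℂ (D x)) fun k => by
      obtain ⟨z, hz⟩ := h k
      refine ⟨‖z‖, fun x => ?_⟩
      rw [innerSL_apply_apply, ← ContinuousLinearMap.adjoint_inner_right, ← hz,
        norm_inner_symm]
      exact (norm_inner_adjoint_le B z x).trans
        (mul_le_of_le_one_right (norm_nonneg _) x.2)
  have hC' : ∀ x, ‖B x‖ ≤ 1 → ‖D x‖ ≤ C := fun x hx => by
    simpa using hC ⟨x, hx⟩
  have hC0 : 0 ≤ C := by simpa using hC' 0 (by simp)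
  refine ⟨C + 1, by positivity, fun x => ?_⟩
  -- On the kernel of `B` every multiple of `x` stays in the set, which forces `D x = 0`. Elsewhere
  -- `x` is rescaled to `‖B x‖ = 1`.
  rcases eq_or_ne (B x) 0 with h0 | h0
  · have h1 : ∀ n : ℕ, n * ‖D x‖ ≤ C := fun n => by
      have := hC' ((n : ℂ) • x) (by simp [h0])
      simpa [norm_smul] using this
    have h2 : ‖D x‖ ≤ 0 := by
      by_contra! hpos
      obtain ⟨n, hn⟩ := exists_nat_gt (C / ‖D x‖)
      rw [div_lt_iff₀ hpos] at hn
      exact absurd (h1 n) (not_le.2 hn)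
    simpa [h0] using h2
  · have hp : 0 < ‖B x‖ := norm_pos_iff.2 h0
    have h1 := hC' (((‖B x‖⁻¹ : ℝ) : ℂ) • x) (by
      rw [map_smul, norm_smul, Complex.norm_real, norm_inv, norm_norm, inv_mul_cancel₀ hp.ne'])
    rw [map_smul, norm_smul, Complex.norm_real, norm_inv, norm_norm,
      inv_mul_le_iff₀ hp] at h1
    nlinarith

/-- Douglas' lemma, stated with norm bounds in place of operator inequalities. -/
theorem range_adjoint_le_iff (B : E →L[ℂ] F) (D : E →L[ℂ] G) :
    (∀ k, ∃ z, adjoint B z = adjoint D k) ↔ ∃ C : ℝ, 0 < C ∧ ∀ x, ‖D x‖ ≤ C * ‖B x‖ := by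
  refine ⟨exists_bound_of_range_adjoint_le B D, fun ⟨C, hC, h⟩ k => ?_⟩
  refine exists_adjoint_eq_of_norm_inner_le B _ (‖k‖ * C) fun x => ?_
  refine (norm_inner_adjoint_le D k x).trans ?_
  rw [mul_assoc]
  exact mul_le_mul_of_nonneg_left (h x) (norm_nonneg _)

end Majorization

/-! ### Defect operators of a contraction -/

section Defect

variable {H E K M : Type*}
  [NormedAddCommGroup H] [InnerProductSpace ℂ H] [CompleteSpace H]
  [NormedAddCommGroup E] [InnerProductSpace ℂ E] [CompleteSpace E]
  [NormedAddCommGroup K] [InnerProductSpace ℂ K] [CompleteSpace K]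
  [NormedAddCommGroup M] [InnerProductSpace ℂ M] [CompleteSpace M]

theorem norm_sub_adjoint_apply_sq (V : H →L[ℂ] E) (x : H) :
    ‖x - adjoint V (V x)‖ ^ 2 = ‖x‖ ^ 2 - 2 * ‖V x‖ ^ 2 + ‖adjoint V (V x)‖ ^ 2 := by
  rw [norm_sub_sq (𝕜 := ℂ), ContinuousLinearMap.adjoint_inner_right, inner_self_eq_norm_sq]

/-- `a` is a defect operator of `V`, that is, `a^* a = I - V^* V`. -/
def IsDefect (V : H →L[ℂ] E) (a : H →L[ℂ] K) : Prop :=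
  ∀ x, ‖a x‖ ^ 2 = ‖x‖ ^ 2 - ‖V x‖ ^ 2

variable {V : H →L[ℂ] E} {a : H →L[ℂ] K} {Y : E →L[ℂ] M}

/-- Over `ℂ` the quadratic form determines the operator. -/
theorem IsDefect.adjoint_apply_apply (ha : IsDefect V a) (x : H) :
    adjoint a (a x) = x - adjoint V (V x) := by
  have h : ((adjoint a ∘L a : H →L[ℂ] H) : H →ₗ[ℂ] H) =
      ((ContinuousLinearMap.id ℂ H - adjoint V ∘L V : H →L[ℂ] H) : H →ₗ[ℂ] H) := by
    refine (ext_inner_map _ _).1 fun x => ?_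
    simp only [ContinuousLinearMap.coe_coe, ContinuousLinearMap.comp_apply, _root_.sub_apply,
      ContinuousLinearMap.id_apply, inner_sub_left, ContinuousLinearMap.adjoint_inner_left,
      inner_self_eq_norm_sq_to_K]
    exact_mod_cast ha x
  exact LinearMap.congr_fun h x

theorem IsDefect.norm_apply_le (ha : IsDefect V a) (x : H) : ‖V x‖ ≤ ‖x‖ :=
  (sq_le_sq₀ (norm_nonneg _) (norm_nonneg _)).1 (by
    have := ha x
    nlinarith [sq_nonneg ‖a x‖])

theorem IsDefect.norm_adjoint_apply_le (ha : IsDefect V a) (z : E) : ‖adjoint V z‖ ≤ ‖z‖ := by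
  have h1 : ‖V‖ ≤ 1 := V.opNorm_le_bound zero_le_one fun x => by
    simpa using ha.norm_apply_le x
  have h2 : ‖adjoint V‖ ≤ 1 := by rwa [LinearIsometryEquiv.norm_map]
  simpa using (adjoint V).le_of_opNorm_le h2 z

/-- The two defects satisfy `‖a x‖² = ‖Y (V x)‖² + ‖x - V^* V x‖²`. It replaces the intertwining
relation between the square roots, so that arbitrary defect operators are allowed. -/
theorem IsDefect.norm_comp_le (ha : IsDefect V a) (hY : IsDefect (adjoint V) Y) (x : H) :
    ‖Y (V x)‖ ≤ ‖a x‖ := by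
  refine (sq_le_sq₀ (norm_nonneg _) (norm_nonneg _)).1 ?_
  have := norm_sub_adjoint_apply_sq V x
  rw [ha, hY]
  nlinarith [sq_nonneg ‖x - adjoint V (V x)‖]

theorem IsDefect.norm_sub_le (ha : IsDefect V a) (x : H) :
    ‖x - adjoint V (V x)‖ ≤ ‖a x‖ := by
  refine (sq_le_sq₀ (norm_nonneg _) (norm_nonneg _)).1 ?_
  have h1 := pow_le_pow_left₀ (norm_nonneg _) (ha.norm_adjoint_apply_le (V x)) 2
  rw [ha, norm_sub_adjoint_apply_sq]
  linarith

/-- Membership in the range of an adjoint is a bound on a functional. Forward, `⟨V a^* y, z⟩ = ⟨y, a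
V^* z⟩` and `‖a V^* z‖ ≤ ‖Y z‖`. Backward, `x` splits as `V^* V x + (x - V^* V x)`, and `‖a x‖`
controls both parts. -/
theorem IsDefect.exists_adjoint_eq_iff (ha : IsDefect V a) (hY : IsDefect (adjoint V) Y)
    (h : H) : (∃ y, adjoint a y = h) ↔ ∃ k, adjoint Y k = V h := by
  have hY' : IsDefect V a → ∀ z, ‖a (adjoint V z)‖ ≤ ‖Y z‖ := fun ha z =>
    hY.norm_comp_le (by rwa [ContinuousLinearMap.adjoint_adjoint]) z
  constructor
  · rintro ⟨y, rfl⟩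
    refine exists_adjoint_eq_of_norm_inner_le Y _ ‖y‖ fun z => ?_
    rw [← ContinuousLinearMap.adjoint_inner_right]
    exact (norm_inner_adjoint_le a y _).trans
      (mul_le_mul_of_nonneg_left (hY' ha z) (norm_nonneg _))
  · rintro ⟨k, hk⟩
    refine exists_adjoint_eq_of_norm_inner_le a _ (‖k‖ + ‖h‖) fun x => ?_
    have h1 : ⟪h, x⟫_ℂ = ⟪adjoint Y k, V x⟫_ℂ + ⟪h, x - adjoint V (V x)⟫_ℂ := by
      rw [hk, inner_sub_right, ContinuousLinearMap.adjoint_inner_right]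
      ring
    rw [h1, add_mul]
    refine (norm_add_le _ _).trans (add_le_add ?_ ?_)
    · exact (norm_inner_adjoint_le Y k _).trans
        (mul_le_mul_of_nonneg_left (ha.norm_comp_le hY x) (norm_nonneg _))
    · exact (norm_inner_le_norm _ _).trans
        (mul_le_mul_of_nonneg_left (ha.norm_sub_le x) (norm_nonneg _))

/-- Every `z` is `V V^* z + (z - V V^* z)`. The second part is already bounded by `‖Y z‖`, so a
bound for `P` need only be checked on the range of `V`. -/
theorem IsDefect.exists_bound_iff {N : Type*} [NormedAddCommGroup N] [InnerProductSpace ℂ N]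
    (ha : IsDefect V a) (hY : IsDefect (adjoint V) Y) (P : E →L[ℂ] N) :
    (∃ C : ℝ, 0 < C ∧ ∀ x, ‖P (V x)‖ ≤ C * ‖a x‖) ↔ ∃ C : ℝ, 0 < C ∧ ∀ z, ‖P z‖ ≤ C * ‖Y z‖ := by
  constructor
  · rintro ⟨C, hC, h⟩
    refine ⟨C + ‖P‖, by positivity, fun z => ?_⟩
    have h0 : IsDefect (adjoint (adjoint V)) a := by rwa [ContinuousLinearMap.adjoint_adjoint]
    have h1 := h (adjoint V z)
    have h2 := mul_le_mul_of_nonneg_left (hY.norm_comp_le h0 z) hC.le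
    have h3 := hY.norm_sub_le z
    rw [ContinuousLinearMap.adjoint_adjoint] at h3
    have h4 := (P.le_opNorm (z - V (adjoint V z))).trans
      (mul_le_mul_of_nonneg_left h3 (norm_nonneg _))
    have h5 : P z = P (V (adjoint V z)) + P (z - V (adjoint V z)) := by
      rw [← map_add, add_sub_cancel]
    rw [h5, add_mul]
    exact (norm_add_le _ _).trans (add_le_add (h1.trans h2) h4)
  · rintro ⟨C, hC, h⟩
    exact ⟨C, hC, fun x => (h _).trans
      (mul_le_mul_of_nonneg_left (ha.norm_comp_le hY x) hC.le)⟩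

end Defect

/-! ### Kernel vectors span the Fock space -/

section WordPoint

variable {d : ℕ}

/-- The nilpotent tuple whose only nonzero monomial entry in the corner is at the word `α`. -/
def wordMatrix (α : List (Fin d)) (j : Fin d) :
    Matrix (Fin (α.length + 1)) (Fin (α.length + 1)) ℂ :=
  .of fun k l => if (l : ℕ) = k + 1 ∧ α[(k : ℕ)]? = some j then 1 / 2 else 0

open scoped Matrix.Norms.L2Operator in
theorem norm_wordMatrix_row_lt (α : List (Fin d)) :
    ‖(Matrix.of fun i jk => wordMatrix α jk.1 i jk.2 :
      Matrix (Fin (α.length + 1)) (Fin d × Fin (α.length + 1)) ℂ)‖ < 1 := by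
  set M : Matrix (Fin (α.length + 1)) (Fin d × Fin (α.length + 1)) ℂ :=
    Matrix.of fun i jk => wordMatrix α jk.1 i jk.2 with hM
  -- Row `k` has at most one nonzero entry, in column `(α_k, k + 1)`, and distinct rows use distinct
  -- columns. Thus `M M^*` is diagonal with entries `1/4` or `0`, and `‖M‖ ≤ 1/2`.
  have h1 : M * M.conjTranspose =
      Matrix.diagonal fun k : Fin (α.length + 1) => if (k : ℕ) < α.length then (1 / 4 : ℂ) else 0 := by
    ext k l
    rw [Matrix.mul_apply, Fintype.sum_prod_type, Matrix.diagonal_apply]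
    simp only [hM, Matrix.conjTranspose_apply, Matrix.of_apply, wordMatrix]
    by_cases hk : (k : ℕ) < α.length
    · rw [Finset.sum_eq_single (α[(k : ℕ)]'hk), Finset.sum_eq_single ⟨k + 1, by omega⟩]
      · by_cases hkl : k = l
        · subst hkl
          simp [hk]
          norm_num
        · have : ¬ ((k : ℕ) = l) := fun h => hkl (Fin.ext h)
          simp [hkl, this]
      · intro m _ hm
        have : ¬ ((m : ℕ) = k + 1) := fun h => hm (Fin.ext h)
        simp [this]
      · simp
      · intro j _ hj
        have : α[(k : ℕ)]? ≠ some j := by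
          rw [List.getElem?_eq_getElem hk]
          simpa using hj.symm
        simp [this]
      · simp
    · simp [hk]
  have h2 : ‖M.conjTranspose.conjTranspose * M.conjTranspose‖ ≤ 1 / 4 := by
    rw [Matrix.conjTranspose_conjTranspose, h1, Matrix.l2_opNorm_diagonal,
      pi_norm_le_iff_of_nonneg (by norm_num)]
    intro k
    split_ifs <;> norm_num
  rw [Matrix.l2_opNorm_conjTranspose_mul_self, Matrix.l2_opNorm_conjTranspose] at h2
  nlinarith [norm_nonneg M]

/-- The point of the NC ball at which the kernel vector is a multiple of `e_α`. -/
def wordPoint (α : List (Fin d)) : NCPoint d where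
  n := α.length + 1
  n_pos := Nat.succ_pos _
  Z := wordMatrix α
  norm_lt := norm_wordMatrix_row_lt α
  y := Pi.single 0 1
  v := Pi.single (Fin.last _) 1

/-- A nonzero entry of a monomial is a path in the states `0, …, |α|`. Each step moves up by one,
reads the prescribed letter of `α` and costs a factor `1/2`. The only path from `k` to the last
state spells out the rest of `α`. -/
theorem wordPoint_mon_last (α β : List (Fin d)) (k : Fin (α.length + 1)) :
    (wordPoint α).mon β k (Fin.last _) = if β = α.drop k then (1 / 2) ^ β.length else 0 := by
  induction β generalizing k with
  | nil =>
    have : (wordPoint α).mon [] = 1 := rfl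
    rw [this]
    refine (Matrix.one_apply (α := ℂ) (i := k) (j := Fin.last _)).trans ?_
    have h : ([] = α.drop k) ↔ k = Fin.last _ := by
      rw [eq_comm, List.drop_eq_nil_iff, Fin.ext_iff, Fin.val_last]
      omega
    simp [h]
  | cons j β ih =>
    rw [NCBall.mon_cons]
    refine (Matrix.mul_apply (M := wordMatrix α j)).trans ?_
    by_cases hk : (k : ℕ) < α.length
    · rw [Finset.sum_eq_single ⟨k + 1, by omega⟩]
      · have hd : α.drop k = α[(k : ℕ)] :: α.drop (k + 1) := List.drop_eq_getElem_cons hk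
        rw [ih, hd]
        by_cases hj : α[(k : ℕ)] = j
        · subst hj
          simp [wordMatrix, pow_succ, mul_comm, -List.getElem_cons_drop]
        · have : ¬ (j = α[(k : ℕ)]) := fun h => hj h.symm
          simp [wordMatrix, List.getElem?_eq_getElem hk, hj, this, -List.getElem_cons_drop]
      · intro m _ hm
        have : ¬ ((m : ℕ) = k + 1) := fun h => hm (Fin.ext h)
        simp [wordMatrix, this]
      · simp
    · have h1 : α[(k : ℕ)]? = none := by simpa using hk
      have h2 : α.drop k = [] := by simpa using hk
      simp [wordMatrix, h1, h2]

theorem wordPoint_coeff (α β : List (Fin d)) :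
    (wordPoint α).coeff β = if β = α then (1 / 2) ^ β.length else 0 := by
  have h := wordPoint_mon_last α β 0
  rw [Fin.val_zero, List.drop_zero] at h
  rw [← h, NCPoint.coeff_eq]
  refine (Finset.sum_eq_single (Fin.last α.length) ?_
    fun h => absurd (Finset.mem_univ _) h).trans ?_
  · intro k _ hk
    simp [wordPoint, hk]
  · refine Eq.trans (congrArg (· * _) (Finset.sum_eq_single (0 : Fin (α.length + 1)) ?_
      fun h => absurd (Finset.mem_univ _) h)) ?_
    · intro k _ hk
      simp [wordPoint, hk]
    · simp [wordPoint]

variable {V : Type*} [NormedAddCommGroup V] [InnerProductSpace ℂ V]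

theorem eval_wordPoint (α : List (Fin d)) (f : FockSpace d V) :
    (wordPoint α).eval f = ((1 / 2 : ℂ) ^ α.length) • f α := by
  rw [NCPoint.eval, tsum_eq_single α]
  · rw [wordPoint_coeff, if_pos rfl]
  · intro β hβ
    rw [wordPoint_coeff, if_neg hβ, zero_smul]

/-- The nilpotent points `wordPoint α` recover every coefficient up to a factor `2^{-|α|}`. -/
theorem eval_injective {f f' : FockSpace d V} (h : ∀ p : NCPoint d, p.eval f = p.eval f') :
    f = f' := by
  ext α
  have := h (wordPoint α)
  rw [eval_wordPoint, eval_wordPoint] at this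
  exact smul_right_injective V (pow_ne_zero _ (by norm_num)) this

/-- A vector orthogonal to all kernel vectors has all its values zero. -/
theorem denseRange_fockSum [CompleteSpace V] :
    DenseRange (RightSchur.fockSum : (NCPoint d × V →₀ ℂ) →ₗ[ℂ] FockSpace d V) := by
  have h2 : Set.range (RightSchur.fockSum : (NCPoint d × V →₀ ℂ) →ₗ[ℂ] FockSpace d V) =
      (LinearMap.range (RightSchur.fockSum : (NCPoint d × V →₀ ℂ) →ₗ[ℂ] FockSpace d V) :
        Set (FockSpace d V)) := rfl
  rw [DenseRange, h2, Submodule.dense_iff_topologicalClosure_eq_top,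
    Submodule.topologicalClosure_eq_top_iff, Submodule.eq_bot_iff]
  intro f hf
  refine eval_injective fun p => ext_inner_left ℂ fun g => ?_
  have h3 := (Submodule.mem_orthogonal _ _).1 hf (p.kvec g) ⟨Finsupp.single (p, g) 1, by
    simp [RightSchur.fockSum]⟩
  rw [← NCPoint.inner_kvec, ← NCPoint.inner_kvec, h3, inner_zero_right]

/-- From `Z_j Z^β = Z^{jβ}`: multiplying a function by `Z_j` is shifting its coefficients. -/
theorem eval_mulLeft [CompleteSpace V] (p : NCPoint d) (j : Fin d) (f : FockSpace d V) :
    (p.mulLeft j).eval f = p.eval (leftShift j f) := by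
  have hc : ∀ β, (p.mulLeft j).coeff β = p.coeff (j :: β) := fun β => by
    rw [NCPoint.coeff, NCPoint.coeff, NCBall.mon_cons, ← Matrix.mulVec_mulVec,
      Matrix.dotProduct_mulVec (star p.y)]
    have : star ((p.Z j).conjTranspose.mulVec p.y) = Matrix.vecMul (star p.y) (p.Z j) := by
      rw [Matrix.star_mulVec, Matrix.conjTranspose_conjTranspose]
    rw [← this]
    rfl
  rw [NCPoint.eval, NCPoint.eval, ← (List.cons_injective (a := j)).tsum_eq
    (f := fun α => p.coeff α • leftShift j f α)]
  · simp only [hc, leftShift_apply, shiftCoeff_cons]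
  · intro α hα
    by_contra hn
    exact hα (by simp [leftShift_apply, shiftCoeff_eq_zero j f α hn])

end WordPoint

variable {d : ℕ} {H J : Type*}
  [NormedAddCommGroup H] [InnerProductSpace ℂ H] [CompleteSpace H]
  [NormedAddCommGroup J] [InnerProductSpace ℂ J] [CompleteSpace J]

namespace RightSchur

variable (A : RightSchur d H J)

/-! ### The de Branges-Rovnyak space inside the Fock space -/

theorem norm_kerSum_le (u : NCPoint d × J →₀ ℂ) :
    ‖A.kerSum u‖ ≤ 1 * ‖(fockSum u : FockSpace d J)‖ := by
  rw [one_mul]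
  refine (sq_le_sq₀ (norm_nonneg _) (norm_nonneg _)).1 ?_
  have := A.norm_kerSum u
  nlinarith [sq_nonneg ‖adjoint A.op (fockSum u)‖]

/-- The contraction `F²_d ⊗ J → ℋ^R(A)` that sends kernel vectors to kernel vectors. -/
def ofFock : FockSpace d J →L[ℂ] A.dbr := A.kerSum.extendOfNorm fockSum

theorem ofFock_fockSum (u : NCPoint d × J →₀ ℂ) : A.ofFock (fockSum u) = A.kerSum u :=
  LinearMap.extendOfNorm_eq denseRange_fockSum ⟨1, A.norm_kerSum_le⟩ u

theorem ofFock_kvec (p : NCPoint d) (g : J) : A.ofFock (p.kvec g) = RKHS.kerFun A.dbr p g := by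
  have := A.ofFock_fockSum (Finsupp.single (p, g) 1)
  simpa [fockSum, kerSum] using this

/-- With the adjoint inclusion this says that `ℋ^R(A)` is the operator range space of `(I - A
A^*)^{1/2}`. Both sides are continuous, so kernel combinations suffice. -/
theorem norm_ofFock_sq (x : FockSpace d J) :
    ‖A.ofFock x‖ ^ 2 = ‖x‖ ^ 2 - ‖adjoint A.op x‖ ^ 2 := by
  refine denseRange_fockSum.induction_on (p := fun x : FockSpace d J =>
    ‖A.ofFock x‖ ^ 2 = ‖x‖ ^ 2 - ‖adjoint A.op x‖ ^ 2) x ?_ fun u => ?_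
  · exact isClosed_eq (by fun_prop) (by fun_prop)
  · rw [ofFock_fockSum, ← A.norm_kerSum u]
    ring

/-- The contractive inclusion `ℋ^R(A) → F²_d ⊗ J`. -/
def toFock : A.dbr →L[ℂ] FockSpace d J := adjoint A.ofFock

theorem eval_toFock (p : NCPoint d) (F : A.dbr) : p.eval (A.toFock F) = F p := by
  refine ext_inner_left ℂ fun g => ?_
  rw [← NCPoint.inner_kvec, toFock, ContinuousLinearMap.adjoint_inner_right, ofFock_kvec,
    RKHS.kerFun_inner]

theorem toFock_injective : Function.Injective A.toFock := fun F G h =>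
  RKHS.ext fun p => by rw [← eval_toFock, ← eval_toFock, h]

theorem toFock_eq_iff (F : A.dbr) (f : FockSpace d J) :
    A.toFock F = f ↔ ∀ p : NCPoint d, F p = p.eval f :=
  ⟨fun h p => by rw [← h, eval_toFock], fun h => eval_injective fun p => by
    rw [eval_toFock, h]⟩

theorem toFock_gleason (h : H) (j : Fin d) : A.toFock (A.gleason h j) =
    adjoint (leftShift j).toContinuousLinearMap (A.op (const h)) :=
  (A.toFock_eq_iff _ _).2 (A.gleason_apply h j)

theorem leftInvariant_iff :
    A.LeftInvariant ↔ ∀ j F, ∃ G : A.dbr, A.toFock G = leftShift j (A.toFock F) := by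
  refine forall_congr' fun j => forall_congr' fun F => exists_congr fun G => ?_
  rw [toFock_eq_iff]
  refine forall_congr' fun p => ?_
  rw [← eval_mulLeft, eval_toFock]

theorem mem_domain_hat_iff (h : H) :
    h ∈ A.hat.domain ↔ ∃ F : A.dbr, A.toFock F = A.op (const h) :=
  exists_congr fun F => (A.toFock_eq_iff F _).symm

theorem toFock_hat (h : A.hat.domain) : A.toFock (A.hat h) = A.op (const (h : H)) :=
  (A.toFock_eq_iff _ _).2 (A.hat_apply h)

theorem hat_eq {h : H} (hh : h ∈ A.hat.domain) {F : A.dbr} (hF : A.toFock F = A.op (const h)) :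
    A.hat ⟨h, hh⟩ = F :=
  A.toFock_injective ((A.toFock_hat _).trans hF.symm)

/-! ### The column `(A(0), 𝐀)` and its defect operators -/

/-- The Hilbert space `J ⊕ (ℋ^R(A) ⊗ ℂ^d)`. -/
abbrev ColSpace : Type _ := WithLp 2 (J × PiLp 2 (fun _ : Fin d => A.dbr))

/-- The contraction `h ↦ (A(0) h, 𝐀 h)`. -/
def column : H →L[ℂ] A.ColSpace :=
  (WithLp.prodContinuousLinearEquiv 2 ℂ J (PiLp 2 (fun _ : Fin d => A.dbr))).symm.toContinuousLinearMap ∘L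
    A.zeroVal.prod A.gleason

theorem column_fst (h : H) : (A.column h).fst = A.zeroVal h := rfl

theorem column_snd (h : H) : (A.column h).snd = A.gleason h := rfl

/-- The embedding `(g, F) ↦ I ⊗ g + ∑ j, L_j F_j` of `J ⊕ (ℋ^R(A) ⊗ ℂ^d)` in the Fock space. -/
def colFock : A.ColSpace →L[ℂ] FockSpace d J :=
  const ∘L WithLp.fstL 2 ℂ J (PiLp 2 (fun _ : Fin d => A.dbr)) +
    ∑ j, (leftShift j).toContinuousLinearMap ∘L A.toFock ∘L
      PiLp.proj 2 (fun _ : Fin d => A.dbr) j ∘L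
        WithLp.sndL 2 ℂ J (PiLp 2 (fun _ : Fin d => A.dbr))

theorem colFock_apply (x : A.ColSpace) :
    A.colFock x = colVec x.fst fun j => A.toFock (x.snd j) := by
  simp [colFock, colVec, _root_.sum_apply]

/-- The constants and the ranges of the `L_j` are mutually orthogonal, and `toFock` is injective. -/
theorem colFock_injective : Function.Injective A.colFock := by
  refine (injective_iff_map_eq_zero _).2 fun x hx => ?_
  have h1 := norm_colVec x.fst fun j => A.toFock (x.snd j)
  rw [← colFock_apply, hx, norm_zero, zero_pow two_ne_zero] at h1
  have h2 : 0 ≤ ∑ j, ‖A.toFock (x.snd j)‖ ^ 2 := by positivity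
  have h3 : x.fst = 0 := by
    have : ‖x.fst‖ ^ 2 = 0 := by nlinarith [sq_nonneg ‖x.fst‖]
    simpa using this
  have h4 : ∑ j, ‖A.toFock (x.snd j)‖ ^ 2 = 0 := by nlinarith [sq_nonneg ‖x.fst‖]
  rw [Finset.sum_eq_zero_iff_of_nonneg fun _ _ => by positivity] at h4
  have h5 : x.snd = 0 := by
    ext1 j
    refine A.toFock_injective ?_
    have := h4 j (Finset.mem_univ j)
    simpa using this
  have h6 : ‖x‖ ^ 2 = 0 := by
    rw [WithLp.prod_norm_sq_eq_of_L2, h3, h5]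
    simp
  simpa using h6

/-- A word is empty or begins with a unique letter. -/
theorem eq_colVec {V : Type*} [NormedAddCommGroup V] [InnerProductSpace ℂ V] [CompleteSpace V]
    (f : FockSpace d V) :
    f = colVec (f []) fun j => adjoint (leftShift j).toContinuousLinearMap f := by
  have h0 : ∀ (g : FockSpace d V) (j : Fin d) α, leftShift j g α = shiftCoeff j g α :=
    fun _ _ _ => rfl
  ext α
  rw [colVec, lp.coeFn_add, Pi.add_apply, lp.coeFn_sum, Finset.sum_apply]
  simp only [h0]
  cases α with
  | nil => simp [shiftCoeff, const_apply]
  | cons i β => simp [shiftCoeff, const_apply, adjoint_leftShift_apply]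

theorem colFock_column (h : H) : A.colFock (A.column h) = A.op (const h) := by
  rw [colFock_apply, column_fst, column_snd]
  simp only [toFock_gleason]
  have := eq_colVec (A.op (const h))
  rw [op_const] at this
  exact this.symm

theorem inner_const_right {V : Type*} [NormedAddCommGroup V] [InnerProductSpace ℂ V]
    (x : FockSpace d V) (h : V) : ⟪x, const h⟫_ℂ = ⟪x [], h⟫_ℂ :=
  lp.inner_single_right (𝕜 := ℂ) (G := fun _ : List (Fin d) => V) [] h x

theorem adjoint_column_adjoint_colFock (u : FockSpace d J) :
    adjoint A.column (adjoint A.colFock u) = adjoint A.op u [] := by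
  refine ext_inner_right ℂ fun h => ?_
  rw [ContinuousLinearMap.adjoint_inner_left, ContinuousLinearMap.adjoint_inner_left,
    colFock_column, ← inner_const_right, ContinuousLinearMap.adjoint_inner_left]

theorem inner_colVec {V : Type*} [NormedAddCommGroup V] [InnerProductSpace ℂ V] [CompleteSpace V]
    (f : FockSpace d V) (g : V) (u : Fin d → FockSpace d V) :
    ⟪f, colVec g u⟫_ℂ = ⟪f [], g⟫_ℂ +
      ∑ j, ⟪adjoint (leftShift j).toContinuousLinearMap f, u j⟫_ℂ := by
  simp only [colVec, inner_add_right, inner_sum, inner_const_right,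
    ContinuousLinearMap.adjoint_inner_left, LinearIsometry.coe_toContinuousLinearMap]

theorem adjoint_colFock_apply (u : FockSpace d J) : adjoint A.colFock u = WithLp.toLp 2
    (u [], WithLp.toLp 2 fun j =>
      A.ofFock (adjoint (leftShift j).toContinuousLinearMap u)) := by
  refine ext_inner_right ℂ fun x => ?_
  rw [ContinuousLinearMap.adjoint_inner_left, colFock_apply, inner_colVec,
    WithLp.prod_inner_apply, PiLp.inner_apply]
  simp only [toFock, ContinuousLinearMap.adjoint_inner_right]
  rfl

theorem norm_sq_eq_vacuum_add {V : Type*} [NormedAddCommGroup V] [InnerProductSpace ℂ V]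
    [CompleteSpace V] (f : FockSpace d V) :
    ‖f‖ ^ 2 = ‖f []‖ ^ 2 + ∑ j, ‖adjoint (leftShift j).toContinuousLinearMap f‖ ^ 2 := by
  conv_lhs => rw [eq_colVec f]
  rw [norm_colVec]

theorem adjoint_leftShift_adjoint_op (j : Fin d) (u : FockSpace d J) :
    adjoint (leftShift j).toContinuousLinearMap (adjoint A.op u) =
      adjoint A.op (adjoint (leftShift j).toContinuousLinearMap u) := by
  refine ext_inner_right ℂ fun x => ?_
  simp only [ContinuousLinearMap.adjoint_inner_left, LinearIsometry.coe_toContinuousLinearMap,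
    op_leftShift]

/-- The defects of the `L_j^* u` add up: since `L_j^*` commutes with `A(R)^*`, their sum is the
defect of `u` except for the two vacuum components. The one of `u` is the first coordinate of
`colFock^* u`. The one of `A(R)^* u` is `V^* colFock^* u`, and this makes `colDefect` a defect of
`V^*`. -/
theorem norm_adjoint_colFock_sq (u : FockSpace d J) :
    ‖adjoint A.colFock u‖ ^ 2 = ‖A.ofFock u‖ ^ 2 + ‖adjoint A.op u []‖ ^ 2 := by
  have h1 := norm_sq_eq_vacuum_add u
  have h2 := norm_sq_eq_vacuum_add (adjoint A.op u)
  simp only [adjoint_leftShift_adjoint_op] at h2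
  rw [adjoint_colFock_apply, WithLp.prod_norm_sq_eq_of_L2, PiLp.norm_sq_eq_of_L2]
  change ‖u []‖ ^ 2 + ∑ j, ‖A.ofFock (adjoint (leftShift j).toContinuousLinearMap u)‖ ^ 2 = _
  simp only [norm_ofFock_sq, Finset.sum_sub_distrib]
  linarith

theorem denseRange_adjoint_colFock : DenseRange (adjoint A.colFock) := by
  have h : (LinearMap.range (adjoint A.colFock : FockSpace d J →ₗ[ℂ] A.ColSpace))ᗮ = ⊥ := by
    rw [Submodule.eq_bot_iff]
    intro x hx
    refine A.colFock_injective (ext_inner_left ℂ fun u => ?_)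
    rw [← ContinuousLinearMap.adjoint_inner_left, map_zero, inner_zero_right]
    exact (Submodule.mem_orthogonal _ _).1 hx _ ⟨u, rfl⟩
  exact (Submodule.dense_iff_topologicalClosure_eq_top).2
    ((Submodule.topologicalClosure_eq_top_iff).2 h)

theorem norm_ofFock_le (u : FockSpace d J) : ‖A.ofFock u‖ ≤ 1 * ‖adjoint A.colFock u‖ := by
  rw [one_mul]
  refine (sq_le_sq₀ (norm_nonneg _) (norm_nonneg _)).1 ?_
  rw [norm_adjoint_colFock_sq]
  nlinarith [sq_nonneg ‖adjoint A.op u []‖]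

/-- A defect operator of the row `(A(0), 𝐀)^*`. -/
def colDefect : A.ColSpace →L[ℂ] A.dbr :=
  (A.ofFock : FockSpace d J →ₗ[ℂ] A.dbr).extendOfNorm
    (adjoint A.colFock : FockSpace d J →ₗ[ℂ] A.ColSpace)

theorem colDefect_adjoint_colFock (u : FockSpace d J) :
    A.colDefect (adjoint A.colFock u) = A.ofFock u :=
  LinearMap.extendOfNorm_eq A.denseRange_adjoint_colFock ⟨1, A.norm_ofFock_le⟩ u

theorem isDefect_colDefect : IsDefect (adjoint A.column) A.colDefect := fun x => by
  refine A.denseRange_adjoint_colFock.induction_on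
    (p := fun x => ‖A.colDefect x‖ ^ 2 = ‖x‖ ^ 2 - ‖adjoint A.column x‖ ^ 2) x ?_ fun u => ?_
  · exact isClosed_eq (by fun_prop) (by fun_prop)
  · rw [colDefect_adjoint_colFock, adjoint_column_adjoint_colFock, norm_adjoint_colFock_sq]
    ring

/-- The adjoint of the relation that defines `colDefect`. -/
theorem colFock_adjoint_colDefect (F : A.dbr) :
    A.colFock (adjoint A.colDefect F) = A.toFock F := by
  refine ext_inner_left ℂ fun u => ?_
  rw [← ContinuousLinearMap.adjoint_inner_left, ContinuousLinearMap.adjoint_inner_right,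
    colDefect_adjoint_colFock, toFock, ContinuousLinearMap.adjoint_inner_right]

theorem adjoint_colDefect_eq_iff (F : A.dbr) (x : A.ColSpace) :
    adjoint A.colDefect F = x ↔ A.toFock F = A.colFock x := by
  rw [← colFock_adjoint_colDefect, A.colFock_injective.eq_iff]

theorem mem_domain_hat_iff_column (h : H) :
    h ∈ A.hat.domain ↔ ∃ F, adjoint A.colDefect F = A.column h := by
  rw [mem_domain_hat_iff]
  simp only [adjoint_colDefect_eq_iff, colFock_column]

theorem adjoint_colDefect_hat (h : A.hat.domain) :
    adjoint A.colDefect (A.hat h) = A.column h := by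
  rw [adjoint_colDefect_eq_iff, colFock_column, toFock_hat]

theorem adjoint_aEmpty : adjoint A.aEmpty = A.aEmpty := by
  have := ((ContinuousLinearMap.nonneg_iff_isPositive _).1 A.aEmpty_nonneg).isSelfAdjoint
  exact this.adjoint_eq

theorem inner_aEmpty_aEmpty (x y : H) :
    ⟪A.aEmpty (A.aEmpty x), y⟫_ℂ = ⟪x, y⟫_ℂ - ⟪A.column x, A.column y⟫_ℂ := by
  have h : A.aEmpty (A.aEmpty x) = (A.defectZero - A.gleasonSq) x := by
    rw [← aEmpty_mul_self]
    rfl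
  rw [h, WithLp.prod_inner_apply]
  simp only [defectZero, gleasonSq, _root_.sub_apply, inner_sub_left,
    ContinuousLinearMap.comp_apply, ContinuousLinearMap.id_apply,
    ContinuousLinearMap.adjoint_inner_left]
  rw [sub_sub]
  rfl

theorem isDefect_aEmpty : IsDefect A.column A.aEmpty := fun x => by
  have h := A.inner_aEmpty_aEmpty x x
  rw [← A.adjoint_aEmpty, ContinuousLinearMap.adjoint_inner_left, A.adjoint_aEmpty] at h
  simp only [inner_self_eq_norm_sq_to_K] at h
  exact_mod_cast h

theorem range_aEmpty : A.aEmpty.range = A.hat.domain := by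
  ext h
  rw [mem_domain_hat_iff_column, ← A.isDefect_aEmpty.exists_adjoint_eq_iff A.isDefect_colDefect,
    adjoint_aEmpty]
  rfl

/-! ### Invariance under the left shifts -/

/-- The projection of `J ⊕ (ℋ^R(A) ⊗ ℂ^d)` onto its second summand. -/
def colSnd : A.ColSpace →L[ℂ] PiLp 2 (fun _ : Fin d => A.dbr) :=
  WithLp.sndL 2 ℂ J (PiLp 2 (fun _ : Fin d => A.dbr))

theorem adjoint_colSnd_apply (k : PiLp 2 (fun _ : Fin d => A.dbr)) :
    adjoint A.colSnd k = WithLp.toLp 2 (0, k) := by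
  refine ext_inner_right ℂ fun x => ?_
  rw [ContinuousLinearMap.adjoint_inner_left, WithLp.prod_inner_apply]
  simp [colSnd]

theorem colFock_adjoint_colSnd (k : PiLp 2 (fun _ : Fin d => A.dbr)) :
    A.colFock (adjoint A.colSnd k) = ∑ j, leftShift j (A.toFock (k j)) := by
  rw [adjoint_colSnd_apply, colFock_apply, colVec]
  simp

/-- Since `ℋ^R(A)` is a linear space, invariance under each shift is the same as containing every `∑
j, L_j F_j`, the image of `(0, F)` under `colFock`. -/
theorem leftInvariant_iff_range_colDefect :
    A.LeftInvariant ↔ ∀ k, ∃ F, adjoint A.colDefect F = adjoint A.colSnd k := by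
  simp only [leftInvariant_iff, adjoint_colDefect_eq_iff, colFock_adjoint_colSnd]
  constructor
  · intro h k
    choose G hG using fun j => h j (k j)
    exact ⟨∑ j, G j, by simp only [map_sum, hG]⟩
  · intro h j F
    obtain ⟨G, hG⟩ := h (WithLp.toLp 2 (Pi.single j F))
    refine ⟨G, hG.trans ?_⟩
    rw [Finset.sum_eq_single j]
    · simp
    · intro i _ hi
      simp [hi]
    · simp

theorem leftInvariant_iff_bound :
    A.LeftInvariant ↔ ∃ C : ℝ, 0 < C ∧ ∀ x, ‖A.gleason x‖ ≤ C * ‖A.aEmpty x‖ := by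
  rw [leftInvariant_iff_range_colDefect, range_adjoint_le_iff,
    ← A.isDefect_aEmpty.exists_bound_iff A.isDefect_colDefect A.colSnd]
  rfl

theorem leftInvariant_iff_range_le :
    A.LeftInvariant ↔ (adjoint A.gleason).range ≤ A.aEmpty.range := by
  rw [leftInvariant_iff_bound, ← range_adjoint_le_iff, adjoint_aEmpty]
  constructor
  · rintro h _ ⟨k, rfl⟩
    exact h k
  · intro h k
    exact h ⟨k, rfl⟩

/-! ### Invariance as an inequality of quadratic forms -/

theorem inner_gleasonSq (x : H) : ⟪A.gleasonSq x, x⟫_ℂ = ((‖A.gleason x‖ ^ 2 : ℝ) : ℂ) := by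
  rw [gleasonSq, ContinuousLinearMap.comp_apply, ContinuousLinearMap.adjoint_inner_left,
    inner_self_eq_norm_sq_to_K]
  push_cast
  rfl

theorem inner_defectZero (x : H) :
    ⟪A.defectZero x, x⟫_ℂ = ((‖x‖ ^ 2 - ‖A.zeroVal x‖ ^ 2 : ℝ) : ℂ) := by
  rw [defectZero, _root_.sub_apply, inner_sub_left, ContinuousLinearMap.comp_apply,
    ContinuousLinearMap.adjoint_inner_left, ContinuousLinearMap.id_apply,
    inner_self_eq_norm_sq_to_K, inner_self_eq_norm_sq_to_K]
  push_cast
  rfl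

theorem le_iff_of_inner_eq {S T : H →L[ℂ] H} {s t : H → ℝ}
    (hS : ∀ x, ⟪S x, x⟫_ℂ = s x) (hT : ∀ x, ⟪T x, x⟫_ℂ = t x) : S ≤ T ↔ ∀ x, s x ≤ t x := by
  rw [ContinuousLinearMap.le_def, ContinuousLinearMap.isPositive_iff_complex]
  refine forall_congr' fun x => ?_
  have h : ⟪(T - S) x, x⟫_ℂ = ((t x - s x : ℝ) : ℂ) := by
    rw [_root_.sub_apply, inner_sub_left, hS, hT]
    push_cast
    rfl
  rw [h]
  simp

theorem norm_aEmpty_sq (x : H) :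
    ‖A.aEmpty x‖ ^ 2 = ‖x‖ ^ 2 - ‖A.zeroVal x‖ ^ 2 - ‖A.gleason x‖ ^ 2 := by
  rw [A.isDefect_aEmpty, WithLp.prod_norm_sq_eq_of_L2, ← sub_sub]
  rfl

theorem inner_smul_defectZero (r : ℝ) (x : H) : ⟪((r : ℂ) • A.defectZero) x, x⟫_ℂ =
    ((r * (‖x‖ ^ 2 - ‖A.zeroVal x‖ ^ 2) : ℝ) : ℂ) := by
  rw [_root_.smul_apply, inner_smul_left, inner_defectZero, Complex.conj_ofReal]
  push_cast
  rfl

theorem gleasonSq_le_iff (ρ : ℝ) : A.gleasonSq ≤ (ρ : ℂ) • A.defectZero ↔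
    ∀ x, ‖A.gleason x‖ ^ 2 ≤ ρ * (‖x‖ ^ 2 - ‖A.zeroVal x‖ ^ 2) :=
  le_iff_of_inner_eq A.inner_gleasonSq (A.inner_smul_defectZero ρ)

theorem leftInvariant_iff_gleasonSq_le : A.LeftInvariant ↔
    ∃ ρ : ℝ, 0 < ρ ∧ ρ < 1 ∧ A.gleasonSq ≤ (ρ : ℂ) • A.defectZero := by
  simp only [leftInvariant_iff_bound, gleasonSq_le_iff]
  constructor
  · rintro ⟨C, hC, h⟩
    have hC2 : 0 < 1 + C ^ 2 := by positivity
    -- Solves `‖𝐀 x‖² ≤ C² (q - ‖𝐀 x‖²)` for `‖𝐀 x‖²`, where `q = ‖x‖² - ‖A(0) x‖²`. The converse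
    -- inverts this, with `C² = ρ / (1 - ρ)`.
    refine ⟨C ^ 2 / (1 + C ^ 2), by positivity, (div_lt_one hC2).2 (by linarith), fun x => ?_⟩
    have h1 := pow_le_pow_left₀ (norm_nonneg _) (h x) 2
    rw [mul_pow, norm_aEmpty_sq] at h1
    rw [div_mul_eq_mul_div, le_div_iff₀ hC2]
    linarith
  · rintro ⟨ρ, h0, h1, h⟩
    have h2 : 0 < 1 - ρ := by linarith
    refine ⟨√(ρ / (1 - ρ)), by positivity, fun x => ?_⟩
    refine (sq_le_sq₀ (norm_nonneg _) (by positivity)).1 ?_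
    rw [mul_pow, Real.sq_sqrt (by positivity), norm_aEmpty_sq, div_mul_eq_mul_div,
      le_div_iff₀ h2]
    have := h x
    linarith

/-! ### The inverse of `I + Â^* Â` -/

/-- `a_∅²` is the inverse of `I + Â^* Â` when `Â` is densely defined. -/
theorem isInvOneAddStarMul_hat (hd : Dense (A.hat.domain : Set H)) :
    IsInvOneAddStarMul A.hat (A.aEmpty * A.aEmpty) := by
  have key : ∀ y : H, ∃ (hx : A.aEmpty (A.aEmpty y) ∈ A.hat.domain)
      (hSx : A.hat ⟨_, hx⟩ ∈ A.hat.adjoint.domain),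
      A.aEmpty (A.aEmpty y) + A.hat.adjoint ⟨_, hSx⟩ = y := by
    intro y
    have hx : A.aEmpty (A.aEmpty y) ∈ A.hat.domain := by
      rw [← range_aEmpty]
      exact ⟨_, rfl⟩
    have hin : ∀ h : A.hat.domain, ⟪y - A.aEmpty (A.aEmpty y), (h : H)⟫_ℂ =
        ⟪A.hat ⟨_, hx⟩, A.hat h⟫_ℂ := by
      -- Because `Y^* Y V y = V y - V V^* V y = V a² y`, whose image in the Fock space is the
      -- function `A a² y`.
      have hF : A.hat ⟨_, hx⟩ = A.colDefect (A.column y) := by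
        refine A.hat_eq hx ?_
        rw [← colFock_adjoint_colDefect, A.isDefect_colDefect.adjoint_apply_apply,
          ContinuousLinearMap.adjoint_adjoint, ← map_sub, colFock_column,
          ← A.isDefect_aEmpty.adjoint_apply_apply, adjoint_aEmpty]
      intro h
      rw [hF, ← ContinuousLinearMap.adjoint_inner_right, adjoint_colDefect_hat, inner_sub_left,
        inner_aEmpty_aEmpty]
      ring
    have hSx : A.hat ⟨_, hx⟩ ∈ A.hat.adjoint.domain :=
      LinearPMap.mem_adjoint_domain_of_exists _ ⟨_, hin⟩
    refine ⟨hx, hSx, ?_⟩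
    rw [LinearPMap.adjoint_apply_eq hd ⟨_, hSx⟩ hin]
    abel
  intro x y
  constructor
  · rintro rfl
    exact key y
  · rintro ⟨hx, hSx, h⟩
    obtain ⟨hx', hSx', h'⟩ := key y
    -- Uniqueness by positivity: for the difference `z` of two solutions, pairing the two equations
    -- with `z` gives `-‖z‖² = ‖Â z‖²`. Formal adjointness is used for each solution separately, so
    -- `Â z ∈ Dom Â^*` is never needed.
    have hz := A.hat.domain.sub_mem hx hx'
    have h1 : A.hat ⟨_, hz⟩ = A.hat ⟨_, hx⟩ - A.hat ⟨_, hx'⟩ := by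
      rw [← LinearPMap.map_sub]
      rfl
    have h2 := LinearPMap.adjoint_isFormalAdjoint hd ⟨_, hSx⟩ ⟨_, hz⟩
    have h3 := LinearPMap.adjoint_isFormalAdjoint hd ⟨_, hSx'⟩ ⟨_, hz⟩
    have h4 : A.hat.adjoint ⟨_, hSx⟩ - A.hat.adjoint ⟨_, hSx'⟩ =
        -(x - A.aEmpty (A.aEmpty y)) := by
      rw [eq_sub_of_add_eq' h, eq_sub_of_add_eq' h']
      abel
    have h5 : -⟪x - A.aEmpty (A.aEmpty y), x - A.aEmpty (A.aEmpty y)⟫_ℂ =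
        ⟪A.hat ⟨_, hz⟩, A.hat ⟨_, hz⟩⟫_ℂ := by
      refine Eq.trans ?_ (congrArg (⟪·, A.hat ⟨_, hz⟩⟫_ℂ) h1.symm)
      rw [← inner_neg_left, ← h4, inner_sub_left, inner_sub_left]
      exact congrArg₂ (· - ·) h2 h3
    rw [inner_self_eq_norm_sq_to_K, inner_self_eq_norm_sq_to_K] at h5
    norm_cast at h5
    have h6 : ‖x - A.aEmpty (A.aEmpty y)‖ ^ 2 = 0 := by
      nlinarith [sq_nonneg ‖x - A.aEmpty (A.aEmpty y)‖, sq_nonneg ‖A.hat ⟨_, hz⟩‖]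
    have h7 : x - A.aEmpty (A.aEmpty y) = 0 := by simpa using h6
    exact (sub_eq_zero.1 h7).symm

theorem smul_defectZero_le_iff (r : ℝ) : (r : ℂ) • A.defectZero ≤ A.aEmpty * A.aEmpty ↔
    ∀ x, r * (‖x‖ ^ 2 - ‖A.zeroVal x‖ ^ 2) ≤ ‖A.aEmpty x‖ ^ 2 := by
  refine le_iff_of_inner_eq (A.inner_smul_defectZero r) fun x => ?_
  rw [mul_apply_eq_comp, ← A.adjoint_aEmpty, ContinuousLinearMap.adjoint_inner_left,
    A.adjoint_aEmpty, inner_self_eq_norm_sq_to_K]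
  push_cast
  rfl

/-- The orthogonal complement of the range of the self-adjoint `a_∅` is its kernel. -/
theorem dense_domain_hat (h : ∀ x, A.aEmpty x = 0 → x = 0) :
    Dense (A.hat.domain : Set H) := by
  rw [Submodule.dense_iff_topologicalClosure_eq_top, Submodule.topologicalClosure_eq_top_iff,
    ← range_aEmpty, Submodule.eq_bot_iff]
  intro x hx
  refine h x (ext_inner_left ℂ fun y => ?_)
  rw [inner_zero_right, ← A.adjoint_aEmpty, ContinuousLinearMap.adjoint_inner_right]
  exact (Submodule.mem_orthogonal _ _).1 hx _ ⟨y, rfl⟩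

theorem leftInvariant_of_smul_defectZero_le (hd : Dense (A.hat.domain : Set H)) {r : ℝ}
    (h0 : 0 < r) (h1 : r < 1) {T : H →L[ℂ] H} (hT : IsInvOneAddStarMul A.hat T)
    (hr : (r : ℂ) • A.defectZero ≤ T) : A.LeftInvariant := by
  -- The graph condition determines the inverse, so the given one is `a_∅²`.
  have hTa : T = A.aEmpty * A.aEmpty := by
    ext y
    exact ((A.isInvOneAddStarMul_hat hd _ y).2 ((hT _ y).1 rfl)).symm
  rw [hTa, smul_defectZero_le_iff] at hr
  refine A.leftInvariant_iff_gleasonSq_le.2 ⟨1 - r, by linarith, by linarith,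
    (A.gleasonSq_le_iff _).2 fun x => ?_⟩
  have := hr x
  rw [norm_aEmpty_sq] at this
  linarith

theorem exists_smul_defectZero_le (hp : ∀ h : H, h ≠ 0 → ‖A.zeroVal h‖ < ‖h‖)
    (hL : A.LeftInvariant) : Dense (A.hat.domain : Set H) ∧
      ∃ r : ℝ, 0 < r ∧ r < 1 ∧ ∃ T : H →L[ℂ] H,
        IsInvOneAddStarMul A.hat T ∧ (r : ℂ) • A.defectZero ≤ T := by
  obtain ⟨ρ, h0, h1, h⟩ := A.leftInvariant_iff_gleasonSq_le.1 hL
  rw [gleasonSq_le_iff] at h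
  have ha : ∀ x, (1 - ρ) * (‖x‖ ^ 2 - ‖A.zeroVal x‖ ^ 2) ≤ ‖A.aEmpty x‖ ^ 2 := fun x => by
    have := h x
    rw [norm_aEmpty_sq]
    linarith
  -- If `a_∅ x = 0` then `‖x‖² ≤ ‖A(0) x‖²` because `ρ < 1`, and purity forces `x = 0`.
  have hd : Dense (A.hat.domain : Set H) := A.dense_domain_hat fun x hx => by
    by_contra hne
    have h2 := ha x
    rw [hx, norm_zero, zero_pow two_ne_zero] at h2
    have h3 := pow_lt_pow_left₀ (hp x hne) (norm_nonneg _) two_ne_zero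
    nlinarith
  exact ⟨hd, 1 - ρ, by linarith, by linarith, _, A.isInvOneAddStarMul_hat hd,
    (A.smul_defectZero_le_iff _).2 ha⟩

end RightSchur

end FreeDBR

end

theorem corollary5p11 {d : ℕ} {H J : Type*}
    [NormedAddCommGroup H] [InnerProductSpace ℂ H] [CompleteSpace H]
    [NormedAddCommGroup J] [InnerProductSpace ℂ J] [CompleteSpace J]
    (A : FreeDBR.RightSchur d H J) :
    A.aEmpty.range = A.hat.domain ∧
    (A.LeftInvariant ↔ (ContinuousLinearMap.adjoint A.gleason).range ≤ A.aEmpty.range) ∧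
    (A.LeftInvariant ↔
      ∃ ρ : ℝ, 0 < ρ ∧ ρ < 1 ∧ A.gleasonSq ≤ (ρ : ℂ) • A.defectZero) ∧
    ((Dense (A.hat.domain : Set H) ∧
        ∃ r : ℝ, 0 < r ∧ r < 1 ∧ ∃ T : H →L[ℂ] H,
          FreeDBR.IsInvOneAddStarMul A.hat T ∧ (r : ℂ) • A.defectZero ≤ T) →
      A.LeftInvariant) ∧
    ((∀ h : H, h ≠ 0 → ‖A.zeroVal h‖ < ‖h‖) → A.LeftInvariant →
      Dense (A.hat.domain : Set H) ∧
        ∃ r : ℝ, 0 < r ∧ r < 1 ∧ ∃ T : H →L[ℂ] H,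
          FreeDBR.IsInvOneAddStarMul A.hat T ∧ (r : ℂ) • A.defectZero ≤ T) :=
  ⟨A.range_aEmpty, A.leftInvariant_iff_range_le, A.leftInvariant_iff_gleasonSq_le,
    fun ⟨hd, _, h0, h1, _, hT, hr⟩ => A.leftInvariant_of_smul_defectZero_le hd h0 h1 hT hr,
    A.exists_smul_defectZero_le⟩
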